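/- Let $(X,\Sigma,\mu)$ be a $\sigma$-finite measure space, $\bar\Sigma$ the completion of $\Sigma$, and $\ell:\Sigma\to\bar\Sigma$ a lifting of $\mu$, i.e. $\ell(\varnothing)=\varnothing$, $\ell(X)=X$, $\ell$ preserves finite unions and intersections, $\ell(E)=\ell(F)$ if $\mu(E\Delta F)=0$, and $\mu(E\Delta\ell(E))=0$. Write also $\ell:L^\infty(\mu)\to\mathcal L^\infty(\bar\Sigma)$ for the induced linear continuous map with $\ell([\mathbb 1_E])=\mathbb 1_{\ell(E)}$, where $\mathcal L^\infty(\bar\Sigma)$ is the ring of bounded $\bar\Sigma$-measurable real functions (not identified a.e.). An $L^\infty(\mu)$-normed module is an $L^\infty(\mu)$-module $\mathscr M$ with a pointwise norm $|\cdot|:\mathscr M\to L^\infty(\mu)$ such that $|v|\ge 0$ with equality iff $v=0$, $|v+w|\le|v|+|w|$, $|fv|=|f||v|$; that is complete for the norm $\|v\|=\||v|\|_{L^\infty}$; and in which, for every countable measurable partition $(E_n)$ of $X$ and $(v_n)\subset\mathscr M$ with $\sup_n\|\mathbb 1_{E_n}v_n\|<\infty$, there is $v$ with $\mathbb 1_{E_n}v=\mathbb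 1_{E_n}v_n$ for all $n$. An $\mathcal L^\infty(\bar\Sigma)$-normed module is defined in the same way, with $\bar\Sigma$ and with identities, inequalities and suprema holding at every point. Let $\mathscr M$ be an $L^\infty(\mu)$-normed module. It has a lifting $(\ell\mathscr M,\ell)$: an $\mathcal L^\infty(\bar\Sigma)$-normed module $\ell\mathscr M$ with a linear map $\ell:\mathscr M\to\ell\mathscr M$ such that $|\ell(v)|=\ell(|v|)$ for all $v\in\mathscr M$ and such that the elements obtained by glueing countably many elements of $\ell(\mathscr M)$ along partitions in $\bar\Sigma$ are dense in $\ell\mathscr M$. Fix any such lifting. For $x\in X$ let $S_x=\{x\}$ if $\{x\}\in\bar\Sigma$, and otherwise let $S_x=\ell(A)$ for an atom $A$ of $\mu$ with $x\in\ell(A)$. For $v\in\ell\mathscr M$ put $v_x=\mathbb 1_{S_x}v$; let the fibre at $x$ be $\ell\mathscr M_x=\mathbb 1_{S_x}\cdot\ell\mathscr M$ with the (semi)norm $\|u\|_x=|u|(x)$, and let $\ell\mathscr M_x'$ be the space of linear functionals on it that are continuous for $\|\cdot\|_x$. A section $\omega=(\omega_x)_{x\in X}$, $\omega_x\in\ell\mathscr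 M'_x$, is weakly measurable if for every $v\in\ell\mathscr M$ the function $x\mapsto\langle\omega_x,v_x\rangle$ is measurable off a $\mu$-null set. Two such sections $\omega,\omega'$ are equivalent if for every $v\in\ell\mathscr M$ one has $\langle\omega_x,v_x\rangle=\langle\omega'_x,v_x\rangle$ for $\mu$-a.e. $x$. The pointwise norm of $\omega$ is $$|\omega|=\operatorname{ess\,sup}_s\ \langle\omega_\cdot,s(\cdot)\rangle,$$ over all $s:x\mapsto\sum_{i=1}^nf_i(x)(v_i)_x$ with $f_i:X\to\mathbb R$ $\bar\Sigma$-measurable, $v_i\in\ell\mathscr M$, and $\|s(x)\|_x\le1$ for all $x$. Let $L^\infty_{\sf weak}(\ell\mathscr M'_\star;\mu)$ be the space of equivalence classes $[\omega]$ of weakly measurable sections with $|\omega|\in L^\infty(\mu)$, with the pointwise operations, products with elements of $L^\infty(\mu)$, and pointwise norm. Let $\mathscr M^*$ be the $L^\infty(\mu)$-module of all continuous $L^\infty(\mu)$-linear maps $T:\mathscr M\to L^\infty(\mu)$, with pointwise norm $|T|=\operatorname{ess\,sup}_{\|v\|\le1}|T(v)|$. **Theorem.** $L^\infty_{\sf weak}(\ell\mathscr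 M'_\star;\mu)$ is an $L^\infty(\mu)$-normed module, and the map $$[\omega]\ \longmapsto\ \Big(v\mapsto\big[\,x\mapsto\langle\omega_x,\ell(v)_x\rangle\,\big]\Big)$$ is well defined and is an isomorphism of $L^\infty(\mu)$-normed modules (a bijective, $L^\infty(\mu)$-linear map that preserves the pointwise norm) from $L^\infty_{\sf weak}(\ell\mathscr M'_\star;\mu)$ onto $\mathscr M^*$. -/

import Mathlib

namespace LinftyModule

open MeasureTheory Filter Set
open scoped ENNReal Topology

variable {X : Type*} [MeasurableSpace X] {μ : Measure X}

/-! ### The ring `L^∞(μ)`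

Mathlib's Banach lattice `Lp ℝ ∞ μ`, equipped with the pointwise almost everywhere product. -/

noncomputable instance : Mul (Lp ℝ ∞ μ) :=
  ⟨fun f g => ((Lp.memLp g).mul (Lp.memLp f) (r := ∞)).toLp (fun x => f x * g x)⟩

noncomputable instance : One (Lp ℝ ∞ μ) := ⟨(memLp_top_const (1 : ℝ)).toLp (fun _ => 1)⟩

theorem coeFn_mul (f g : Lp ℝ ∞ μ) : ⇑(f * g) =ᵐ[μ] fun x => f x * g x := MemLp.coeFn_toLp _

theorem coeFn_one : ⇑(1 : Lp ℝ ∞ μ) =ᵐ[μ] fun _ => 1 := MemLp.coeFn_toLp _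

noncomputable instance : CommRing (Lp ℝ ∞ μ) :=
  { (inferInstance : AddCommGroup (Lp ℝ ∞ μ)) with
    mul := (· * ·)
    one := 1
    left_distrib := fun a b c => by
      apply Lp.ext
      filter_upwards [coeFn_mul a (b + c), Lp.coeFn_add b c, Lp.coeFn_add (a * b) (a * c),
        coeFn_mul a b, coeFn_mul a c] with x h1 h2 h3 h4 h5
      simp only [h1, h2, h3, h4, h5, Pi.add_apply]; ring
    right_distrib := fun a b c => by
      apply Lp.ext
      filter_upwards [coeFn_mul (a + b) c, Lp.coeFn_add a b, Lp.coeFn_add (a * c) (b * c),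
        coeFn_mul a c, coeFn_mul b c] with x h1 h2 h3 h4 h5
      simp only [h1, h2, h3, h4, h5, Pi.add_apply]; ring
    zero_mul := fun a => by
      apply Lp.ext
      filter_upwards [coeFn_mul 0 a, Lp.coeFn_zero ℝ ∞ μ] with x h1 h2
      have h3 : (0 : Lp ℝ ∞ μ) x = 0 := h2
      rw [h1, h3]
      exact zero_mul _
    mul_zero := fun a => by
      apply Lp.ext
      filter_upwards [coeFn_mul a 0, Lp.coeFn_zero ℝ ∞ μ] with x h1 h2
      have h3 : (0 : Lp ℝ ∞ μ) x = 0 := h2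
      rw [h1, h3]
      exact mul_zero _
    mul_assoc := fun a b c => by
      apply Lp.ext
      filter_upwards [coeFn_mul (a * b) c, coeFn_mul a b, coeFn_mul a (b * c),
        coeFn_mul b c] with x h1 h2 h3 h4
      simp only [h1, h2, h3, h4]; ring
    one_mul := fun a => by
      apply Lp.ext
      filter_upwards [coeFn_mul 1 a, coeFn_one (μ := μ)] with x h1 h2
      simp [h1, h2]
    mul_one := fun a => by
      apply Lp.ext
      filter_upwards [coeFn_mul a 1, coeFn_one (μ := μ)] with x h1 h2
      simp [h1, h2]
    mul_comm := fun a b => by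
      apply Lp.ext
      filter_upwards [coeFn_mul a b, coeFn_mul b a] with x h1 h2
      simp only [h1, h2]; ring }

noncomputable instance : Algebra ℝ (Lp ℝ ∞ μ) :=
  Algebra.ofModule
    (fun r a b => by
      apply Lp.ext
      filter_upwards [coeFn_mul (r • a) b, Lp.coeFn_smul r a, Lp.coeFn_smul r (a * b),
        coeFn_mul a b] with x h1 h2 h3 h4
      simp only [h1, h2, h3, h4, Pi.smul_apply, smul_eq_mul]; ring)
    (fun r a b => by
      apply Lp.ext
      filter_upwards [coeFn_mul a (r • b), Lp.coeFn_smul r b, Lp.coeFn_smul r (a * b),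
        coeFn_mul a b] with x h1 h2 h3 h4
      simp only [h1, h2, h3, h4, Pi.smul_apply, smul_eq_mul]; ring)

theorem ae_abs_le_norm (f : Lp ℝ ∞ μ) : ∀ᵐ x ∂μ, |f x| ≤ ‖f‖ := by
  have h := ae_le_eLpNormEssSup (f := f) (μ := μ)
  have hfin : eLpNormEssSup f μ ≠ ∞ := by
    rw [← eLpNorm_exponent_top]; exact (Lp.memLp f).2.ne
  filter_upwards [h] with x hx
  rw [Lp.norm_def, eLpNorm_exponent_top]
  have := ENNReal.toReal_mono hfin hx
  simpa using this

theorem norm_le_of_ae {f : Lp ℝ ∞ μ} {C : ℝ} (hC : 0 ≤ C) (h : ∀ᵐ x ∂μ, |f x| ≤ C) : ‖f‖ ≤ C := by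
  rw [Lp.norm_def, eLpNorm_exponent_top]
  refine ENNReal.toReal_le_of_le_ofReal hC (eLpNormEssSup_le_of_ae_bound ?_)
  simpa using h

theorem norm_mul_le' (f g : Lp ℝ ∞ μ) : ‖f * g‖ ≤ ‖f‖ * ‖g‖ := by
  refine norm_le_of_ae (by positivity) ?_
  filter_upwards [coeFn_mul f g, ae_abs_le_norm f, ae_abs_le_norm g] with x h1 h2 h3
  rw [h1, abs_mul]; gcongr

/-- The class in `L^∞(μ)` of the characteristic function of the measurable set `E`. -/
noncomputable def ind (μ : Measure X) (E : Set X) (hE : MeasurableSet E) : Lp ℝ ∞ μ :=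
  ((memLp_top_const (1 : ℝ)).indicator hE).toLp (E.indicator fun _ => 1)

/-! ### Essential suprema of families -/

/-- Any family of (classes of) measurable `[0,∞]`-valued functions on a `σ`-finite space has an
essential supremum, that is, a least upper bound for the almost everywhere order. -/
theorem exists_isLUB [SigmaFinite μ] (S : Set (X →ₘ[μ] ℝ≥0∞)) : ∃ g, IsLUB S g := by
  classical
  let ν := μ.toFinite
  have hae : ae ν = ae μ := ae_toFinite
  let φ : ℝ≥0∞ → ℝ≥0∞ := fun t => (ENNReal.orderIsoIicOneBirational t : ℝ≥0∞)
  have hφ : StrictMono φ := fun a b h => by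
    simpa [φ] using ENNReal.orderIsoIicOneBirational.strictMono h
  have hφ1 : ∀ t, φ t ≤ 1 := fun t => (ENNReal.orderIsoIicOneBirational t).2
  let G : Set (X →ₘ[μ] ℝ≥0∞) → X → ℝ≥0∞ := fun c x => ⨆ s ∈ c, s x
  have hG : ∀ c : Set (X →ₘ[μ] ℝ≥0∞), c.Countable → Measurable (G c) := fun c hc =>
    Measurable.biSup c hc (fun s _ => s.measurable)
  let J : Set (X →ₘ[μ] ℝ≥0∞) → ℝ≥0∞ := fun c => ∫⁻ x, φ (G c x) ∂ν
  have hJmono : ∀ c d, c ⊆ d → J c ≤ J d := fun c d h =>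
    lintegral_mono fun x => hφ.monotone (biSup_mono h)
  let T : Set ℝ≥0∞ := J '' {c | c ⊆ S ∧ c.Countable}
  have hT : T.Nonempty := ⟨_, ∅, ⟨empty_subset _, countable_empty⟩, rfl⟩
  obtain ⟨u, -, hu, huT⟩ := exists_seq_tendsto_sSup hT (OrderTop.bddAbove T)
  choose c hc hcu using huT
  let d := ⋃ n, c n
  have hdS : d ⊆ S := iUnion_subset fun n => (hc n).1
  have hdc : d.Countable := countable_iUnion fun n => (hc n).2
  have hJd : sSup T ≤ J d := le_of_tendsto' hu fun n => by
    rw [← hcu n]; exact hJmono _ _ (subset_iUnion c n)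
  have hfin : J d ≠ ∞ := by
    have : J d ≤ ∫⁻ _, 1 ∂ν := lintegral_mono fun x => hφ1 _
    refine ne_top_of_le_ne_top ?_ this
    simp [measure_ne_top]
  refine ⟨AEEqFun.mk (G d) (hG d hdc).aestronglyMeasurable, ?_, ?_⟩
  · intro s hs
    have h1 : J (insert s d) ≤ J d := le_trans
      (le_sSup (s := T) (a := J (insert s d))
        ⟨_, ⟨insert_subset hs hdS, hdc.insert s⟩, rfl⟩) hJd
    have h2 := ae_eq_of_ae_le_of_lintegral_le (μ := ν) (f := fun x => φ (G d x))
      (g := fun x => φ (G (insert s d) x))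
      (ae_of_all _ fun x => hφ.monotone (biSup_mono (subset_insert s d))) hfin
      (hφ.monotone.measurable.comp (hG _ (hdc.insert s))).aemeasurable h1
    rw [EventuallyEq, hae] at h2
    rw [← AEEqFun.coeFn_le]
    filter_upwards [h2, AEEqFun.coeFn_mk (G d) (hG d hdc).aestronglyMeasurable (μ := μ)]
      with x hx hx'
    rw [hx', hφ.injective hx]
    exact le_biSup (fun s : X →ₘ[μ] ℝ≥0∞ => s x) (mem_insert s d)
  · intro h hh
    rw [← AEEqFun.coeFn_le]
    have : ∀ᵐ x ∂μ, ∀ s ∈ d, s x ≤ h x := (ae_ball_iff hdc).2 fun s hs =>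
      AEEqFun.coeFn_le.2 (hh (hdS hs))
    filter_upwards [this, AEEqFun.coeFn_mk (G d) (hG d hdc).aestronglyMeasurable (μ := μ)]
      with x hx hx'
    rw [hx']
    exact iSup₂_le hx



/-- The essential supremum of a family of measurable `[0,∞]`-valued functions. -/
noncomputable def essSupSet [SigmaFinite μ] (S : Set (X →ₘ[μ] ℝ≥0∞)) : X →ₘ[μ] ℝ≥0∞ :=
  (exists_isLUB S).choose

theorem isLUB_essSupSet [SigmaFinite μ] (S : Set (X →ₘ[μ] ℝ≥0∞)) : IsLUB S (essSupSet S) :=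
  (exists_isLUB S).choose_spec

/-- An essentially bounded class of `[0,∞]`-valued functions, as an element of `L^∞(μ)`. -/
noncomputable def toLinfty (g : X →ₘ[μ] ℝ≥0∞)
    (hg : ∃ C : ℝ, ∀ᵐ x ∂μ, g x ≤ ENNReal.ofReal C) : Lp ℝ ∞ μ :=
  MemLp.toLp (fun x => (g x).toReal) <| by
    obtain ⟨C, hC⟩ := hg
    refine memLp_top_of_bound g.measurable.ennreal_toReal.aestronglyMeasurable (max C 0) ?_
    filter_upwards [hC] with x hx
    rw [Real.norm_of_nonneg ENNReal.toReal_nonneg, ← ENNReal.toReal_ofReal']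
    exact ENNReal.toReal_mono ENNReal.ofReal_ne_top hx

theorem essSupSet_le [SigmaFinite μ] {S : Set (X →ₘ[μ] ℝ≥0∞)} {C : ℝ}
    (h : ∀ g ∈ S, ∀ᵐ x ∂μ, g x ≤ ENNReal.ofReal C) :
    ∀ᵐ x ∂μ, essSupSet S x ≤ ENNReal.ofReal C := by
  have h1 : essSupSet S ≤ AEEqFun.const X (ENNReal.ofReal C) := by
    refine (isLUB_essSupSet S).2 fun g hg => ?_
    rw [← AEEqFun.coeFn_le]
    filter_upwards [h g hg, AEEqFun.coeFn_const X (ENNReal.ofReal C) (μ := μ)] with x hx hx'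
    rw [hx']; exact hx
  filter_upwards [AEEqFun.coeFn_le.2 h1, AEEqFun.coeFn_const X (ENNReal.ofReal C) (μ := μ)]
    with x hx hx'
  rw [hx'] at hx; exact hx

/-! ### Liftings -/

/-- A lifting `ℓ : Σ → Σ̄` of `μ`, where `Σ̄` (the `μ`-null-measurable sets) is the completion
of the `σ`-algebra `Σ`. Only the values on measurable sets are relevant. -/
structure Lifting (μ : Measure X) where
  toFun : Set X → Set X
  nullMeasurable : ∀ E, MeasurableSet E → NullMeasurableSet (toFun E) μ
  map_empty : toFun ∅ = ∅
  map_univ : toFun univ = univ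
  map_union : ∀ E F, MeasurableSet E → MeasurableSet F → toFun (E ∪ F) = toFun E ∪ toFun F
  map_inter : ∀ E F, MeasurableSet E → MeasurableSet F → toFun (E ∩ F) = toFun E ∩ toFun F
  map_congr : ∀ E F, MeasurableSet E → MeasurableSet F → μ (symmDiff E F) = 0 → toFun E = toFun F
  symmDiff_null : ∀ E, MeasurableSet E → μ (symmDiff E (toFun E)) = 0

instance : CoeFun (Lifting μ) fun _ => Set X → Set X := ⟨Lifting.toFun⟩

/-- `𝓛^∞(Σ̄)`: the algebra of all bounded real functions that are measurable with respect to the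
completion `Σ̄`; functions are not identified almost everywhere. -/
def BddFun (μ : Measure X) : Subalgebra ℝ (X → ℝ) where
  carrier := {f | NullMeasurable f μ ∧ ∃ C, ∀ x, |f x| ≤ C}
  mul_mem' := by
    rintro f g ⟨hf, C, hC⟩ ⟨hg, D, hD⟩
    refine ⟨Measurable.mul (α := NullMeasurableSpace X μ) hf hg, C * D, fun x => ?_⟩
    rw [Pi.mul_apply, abs_mul]
    exact mul_le_mul (hC x) (hD x) (abs_nonneg _) ((abs_nonneg _).trans (hC x))
  add_mem' := by
    rintro f g ⟨hf, C, hC⟩ ⟨hg, D, hD⟩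
    refine ⟨?_, C + D, fun x => (abs_add_le _ _).trans (add_le_add (hC x) (hD x))⟩
    exact Measurable.add (α := NullMeasurableSpace X μ) hf hg
  algebraMap_mem' := fun r => ⟨measurable_const.nullMeasurable, |r|, fun x => le_rfl⟩

namespace Lifting

/-- The sets that contain some measurable `E` with `x ∈ ℓ E`; measurable sets are decided by this
filter, so bounded measurable functions converge along it. -/
def filter (ℓ : Lifting μ) (x : X) : Filter X where
  sets := {A | ∃ E, MeasurableSet E ∧ x ∈ ℓ E ∧ E ⊆ A}
  univ_sets := ⟨univ, .univ, by simp [ℓ.map_univ], subset_rfl⟩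
  sets_of_superset := fun ⟨E, h1, h2, h3⟩ h => ⟨E, h1, h2, h3.trans h⟩
  inter_sets := fun ⟨E, h1, h2, h3⟩ ⟨F, k1, k2, k3⟩ =>
    ⟨E ∩ F, h1.inter k1, by rw [ℓ.map_inter _ _ h1 k1]; exact ⟨h2, k2⟩, inter_subset_inter h3 k3⟩

theorem mem_filter {ℓ : Lifting μ} {x : X} {E : Set X} (hE : MeasurableSet E) (h : x ∈ ℓ E) :
    E ∈ ℓ.filter x := ⟨E, hE, h, subset_rfl⟩

theorem mem_or_compl_mem_filter (ℓ : Lifting μ) (x : X) {E : Set X} (hE : MeasurableSet E) :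
    E ∈ ℓ.filter x ∨ Eᶜ ∈ ℓ.filter x := by
  have : x ∈ ℓ E ∪ ℓ Eᶜ := by rw [← ℓ.map_union _ _ hE hE.compl]; simp [ℓ.map_univ]
  exact this.imp (mem_filter hE) (mem_filter hE.compl)

instance (ℓ : Lifting μ) (x : X) : (ℓ.filter x).NeBot :=
  ⟨fun h => by
    have : ∅ ∈ ℓ.filter x := by rw [h]; trivial
    obtain ⟨E, -, h2, h3⟩ := this
    rw [subset_empty_iff.1 h3, ℓ.map_empty] at h2
    exact h2⟩

theorem filter_le_ae (ℓ : Lifting μ) (x : X) : ℓ.filter x ≤ ae μ := by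
  intro A hA
  obtain ⟨E, hE, hm, h0⟩ := exists_measurable_superset_of_null (mem_ae_iff.1 hA)
  refine ⟨Eᶜ, hm.compl, ?_, compl_subset_comm.1 hE⟩
  rw [ℓ.map_congr Eᶜ univ hm.compl .univ, ℓ.map_univ]
  · trivial
  · simpa [symmDiff_def] using h0

theorem exists_tendsto (ℓ : Lifting μ) (x : X) (f : Lp ℝ ∞ μ) :
    ∃ a, Tendsto f (ℓ.filter x) (𝓝 a) := by
  have hfm : Measurable f := (Lp.stronglyMeasurable f).measurable
  have hC : f ⁻¹' Icc (-‖f‖) ‖f‖ ∈ ℓ.filter x := ℓ.filter_le_ae x <| by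
    filter_upwards [ae_abs_le_norm f] with y hy using abs_le.1 hy
  let U := Ultrafilter.of (ℓ.filter x)
  have hU : (U : Filter X) ≤ ℓ.filter x := Ultrafilter.of_le _
  obtain ⟨a, -, ha⟩ := isCompact_Icc.ultrafilter_le_nhds (U.map f) (le_principal_iff.2 (hU hC))
  refine ⟨a, (nhds_basis_opens a).tendsto_right_iff.2 fun O hO => ?_⟩
  rcases ℓ.mem_or_compl_mem_filter x (hfm hO.2.measurableSet) with h | h
  · exact h
  · exact absurd (ha (hO.2.mem_nhds hO.1)) (Ultrafilter.compl_mem_iff_notMem.1 (hU h))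

/-- The value at `x` of the lifting of a function `f ∈ L^∞(μ)`. -/
noncomputable def limFun (ℓ : Lifting μ) (f : Lp ℝ ∞ μ) (x : X) : ℝ := limUnder (ℓ.filter x) f

theorem tendsto_limFun (ℓ : Lifting μ) (f : Lp ℝ ∞ μ) (x : X) :
    Tendsto f (ℓ.filter x) (𝓝 (ℓ.limFun f x)) := tendsto_nhds_limUnder (ℓ.exists_tendsto x f)

theorem limFun_eq_of_ae {ℓ : Lifting μ} {f : Lp ℝ ∞ μ} {g : X → ℝ} {x : X} {a : ℝ}
    (h : f =ᵐ[μ] g) (hg : Tendsto g (ℓ.filter x) (𝓝 a)) : ℓ.limFun f x = a :=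
  tendsto_nhds_unique (ℓ.tendsto_limFun f x) (hg.congr' (ℓ.filter_le_ae x h.symm))

theorem abs_limFun_le (ℓ : Lifting μ) (f : Lp ℝ ∞ μ) (x : X) : |ℓ.limFun f x| ≤ ‖f‖ :=
  le_of_tendsto (ℓ.tendsto_limFun f x).abs (ℓ.filter_le_ae x (ae_abs_le_norm f))

theorem limFun_ae_eq (ℓ : Lifting μ) (f : Lp ℝ ∞ μ) : ℓ.limFun f =ᵐ[μ] f := by
  have hfm : Measurable f := (Lp.stronglyMeasurable f).measurable
  have hm : ∀ q : ℚ, MeasurableSet (f ⁻¹' Ioi (q : ℝ)) := fun q => hfm measurableSet_Ioi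
  have key : ∀ᵐ x ∂μ, ∀ q : ℚ, x ∈ f ⁻¹' Ioi (q : ℝ) ↔ x ∈ ℓ (f ⁻¹' Ioi (q : ℝ)) :=
    ae_all_iff.2 fun q => by
      have := measure_symmDiff_eq_zero_iff.1 (ℓ.symmDiff_null _ (hm q))
      filter_upwards [this] with x hx using iff_of_eq hx
  filter_upwards [key] with x hx
  refine le_antisymm (le_of_forall_lt_rat_imp_le fun q hq => ?_)
    (le_of_forall_rat_lt_imp_le fun q hq => ?_)
  · by_contra hlt
    have h2 : ¬ x ∈ ℓ (f ⁻¹' Ioi (q : ℝ)) := fun h => by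
      have := (hx q).2 h
      simp at this; linarith
    have h3 : x ∈ ℓ (f ⁻¹' Ioi (q : ℝ))ᶜ := by
      have : x ∈ ℓ (f ⁻¹' Ioi (q : ℝ)) ∪ ℓ (f ⁻¹' Ioi (q : ℝ))ᶜ := by
        rw [← ℓ.map_union _ _ (hm q) (hm q).compl]; simp [ℓ.map_univ]
      exact this.resolve_left h2
    refine hlt (le_of_tendsto (ℓ.tendsto_limFun f x) ?_)
    filter_upwards [mem_filter (hm q).compl h3] with y hy
    simpa using hy
  · refine ge_of_tendsto (ℓ.tendsto_limFun f x) ?_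
    filter_upwards [mem_filter (hm q) ((hx q).1 hq)] with y hy
    exact le_of_lt hy

/-- The lifting `ℓ : L^∞(μ) → 𝓛^∞(Σ̄)` of functions: the linear map, continuous by
`abs_limFun_le`, that sends the class of `𝟙_E` to `𝟙_{ℓ E}` (see `onLinfty_ind`). -/
noncomputable def onLinfty (ℓ : Lifting μ) : Lp ℝ ∞ μ →ₗ[ℝ] BddFun μ where
  toFun f := ⟨ℓ.limFun f,
    (Lp.stronglyMeasurable f).measurable.nullMeasurable.congr (ℓ.limFun_ae_eq f).symm,
    ‖f‖, ℓ.abs_limFun_le f⟩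
  map_add' f g := by
    ext x
    exact limFun_eq_of_ae (Lp.coeFn_add f g) ((ℓ.tendsto_limFun f x).add (ℓ.tendsto_limFun g x))
  map_smul' c f := by
    ext x
    exact limFun_eq_of_ae (Lp.coeFn_smul c f) ((ℓ.tendsto_limFun f x).const_mul c)

theorem onLinfty_ind (ℓ : Lifting μ) {E : Set X} (hE : MeasurableSet E) :
    (ℓ.onLinfty (ind μ E hE) : X → ℝ) = (ℓ E).indicator fun _ => 1 := by
  funext x
  refine limFun_eq_of_ae (MemLp.coeFn_toLp _) ?_
  have hu : x ∈ ℓ E ∪ ℓ Eᶜ := by rw [← ℓ.map_union _ _ hE hE.compl]; simp [ℓ.map_univ]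
  have hi : ℓ E ∩ ℓ Eᶜ = ∅ := by rw [← ℓ.map_inter _ _ hE hE.compl]; simp [ℓ.map_empty]
  refine tendsto_const_nhds.congr' ?_
  rcases hu with h | h
  · filter_upwards [mem_filter hE h] with y hy
    simp [h, hy]
  · have h' : x ∉ ℓ E := fun h' => by
      have : x ∈ ℓ E ∩ ℓ Eᶜ := ⟨h', h⟩
      rw [hi] at this; exact this
    filter_upwards [mem_filter hE.compl h] with y hy
    simp [h', notMem_of_mem_compl hy]

end Lifting


/-! ### Normed modules -/

/-- The characteristic function of a set of `Σ̄`, as an element of `𝓛^∞(Σ̄)`. -/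
noncomputable def barInd (μ : Measure X) (E : Set X) (hE : NullMeasurableSet E μ) : BddFun μ :=
  ⟨E.indicator fun _ => 1,
    Measurable.indicator (α := NullMeasurableSpace X μ) measurable_const hE, 1,
    fun x => by by_cases h : x ∈ E <;> simp [h]⟩

/-- The module `M` over the ring `L^∞(μ)`, with pointwise norm `nM`, is an `L^∞(μ)`-normed module.
The norm of `v` is the `L^∞(μ)`-norm `‖nM v‖` of its pointwise norm, and `M` is complete for it. -/
structure IsNormedModule {M : Type*} [AddCommGroup M] [Module (Lp ℝ ∞ μ) M]
    (nM : M → Lp ℝ ∞ μ) : Prop where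
  nonneg : ∀ v, 0 ≤ nM v
  eq_zero_iff : ∀ v, nM v = 0 ↔ v = 0
  add_le : ∀ v w, nM (v + w) ≤ nM v + nM w
  smul : ∀ (f : Lp ℝ ∞ μ) (v : M), nM (f • v) = |f| * nM v
  glue : ∀ (E : ℕ → Set X) (hE : ∀ n, MeasurableSet (E n)),
    Pairwise (Function.onFun Disjoint E) → ⋃ n, E n = univ →
    ∀ v : ℕ → M, (∃ C : ℝ, ∀ n, ‖ind μ (E n) (hE n) * nM (v n)‖ ≤ C) →
      ∃ u : M, ∀ n, ind μ (E n) (hE n) • u = ind μ (E n) (hE n) • v n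
  complete : ∀ u : ℕ → M,
    (∀ ε > 0, ∃ N, ∀ m ≥ N, ∀ n ≥ N, ‖nM (u m - u n)‖ ≤ ε) →
      ∃ v : M, ∀ ε > 0, ∃ N, ∀ n ≥ N, ‖nM (u n - v)‖ ≤ ε

/-- The module `L` over the ring `𝓛^∞(Σ̄)`, with pointwise norm `nL`, is an `𝓛^∞(Σ̄)`-normed
module. The norm of `v` is the supremum over all points of its pointwise norm `nL v`, and `L` is
complete for it. -/
structure IsBarNormedModule {L : Type*} [AddCommGroup L] [Module (BddFun μ) L]
    (nL : L → BddFun μ) : Prop where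
  nonneg : ∀ v x, 0 ≤ (nL v : X → ℝ) x
  eq_zero_iff : ∀ v, nL v = 0 ↔ v = 0
  add_le : ∀ v w x, (nL (v + w) : X → ℝ) x ≤ (nL v : X → ℝ) x + (nL w : X → ℝ) x
  smul : ∀ (f : BddFun μ) (v : L) x, (nL (f • v) : X → ℝ) x = |(f : X → ℝ) x| * (nL v : X → ℝ) x
  glue : ∀ (E : ℕ → Set X) (hE : ∀ n, NullMeasurableSet (E n) μ),
    Pairwise (Function.onFun Disjoint E) → ⋃ n, E n = univ →
    ∀ v : ℕ → L, (∃ C : ℝ, ∀ n, ∀ x ∈ E n, (nL (v n) : X → ℝ) x ≤ C) →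
      ∃ u : L, ∀ n, barInd μ (E n) (hE n) • u = barInd μ (E n) (hE n) • v n
  complete : ∀ u : ℕ → L,
    (∀ ε > 0, ∃ N, ∀ m ≥ N, ∀ n ≥ N, ∀ x, (nL (u m - u n) : X → ℝ) x ≤ ε) →
      ∃ v : L, ∀ ε > 0, ∃ N, ∀ n ≥ N, ∀ x, (nL (u n - v) : X → ℝ) x ≤ ε

/-- `g` is obtained by glueing countably many elements of `V` along a partition in `Σ̄`. -/
def IsGlueing {L : Type*} [AddCommGroup L] [Module (BddFun μ) L] (nL : L → BddFun μ)
    (V : Set L) (g : L) : Prop :=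
  ∃ (E : ℕ → Set X) (hE : ∀ n, NullMeasurableSet (E n) μ) (v : ℕ → L),
    Pairwise (Function.onFun Disjoint E) ∧ ⋃ n, E n = univ ∧ (∀ n, v n ∈ V) ∧
    (∃ C : ℝ, ∀ n, ∀ x ∈ E n, (nL (v n) : X → ℝ) x ≤ C) ∧
    ∀ n, barInd μ (E n) (hE n) • g = barInd μ (E n) (hE n) • v n

/-- `(L, lift)` is the lifting of the `L^∞(μ)`-normed module `M`: `|lift v| = ℓ(|v|)` for all `v`,
and the image of `lift` generates `L`, that is, glueings of its elements are dense in `L`. -/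
structure IsModuleLifting (ℓ : Lifting μ) {M : Type*} [AddCommGroup M] [Module (Lp ℝ ∞ μ) M]
    [Module ℝ M] (nM : M → Lp ℝ ∞ μ) {L : Type*} [AddCommGroup L] [Module (BddFun μ) L]
    [Module ℝ L] (nL : L → BddFun μ) (lift : M →ₗ[ℝ] L) : Prop where
  norm_lift : ∀ v, nL (lift v) = ℓ.onLinfty (nM v)
  generates : ∀ (u : L), ∀ ε > 0, ∃ g, IsGlueing nL (range lift) g ∧
    ∀ x, (nL (u - g) : X → ℝ) x ≤ ε

/-! ### Fibres of the lifted module, and sections of their duals -/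

/-- `A` is an atom of `μ`. -/
def IsMeasureAtom (μ : Measure X) (A : Set X) : Prop :=
  MeasurableSet A ∧ μ A ≠ 0 ∧ ∀ B ⊆ A, MeasurableSet B → μ B = 0 ∨ μ (A \ B) = 0

open Classical in
/-- The set that determines the fibre at `x`: the singleton `{x}` if it belongs to `Σ̄`, and
otherwise the lifted atom `ℓ A` containing `x`. (One of the first two cases always applies, and
`ℓ A` does not depend on the choice of the atom `A` with `x ∈ ℓ A`.) -/
noncomputable def Lifting.fibreSet (ℓ : Lifting μ) (x : X) : Set X :=
  if NullMeasurableSet {x} μ then {x}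
  else if h : ∃ A, IsMeasureAtom μ A ∧ x ∈ ℓ A then ℓ h.choose
  else ∅

theorem Lifting.nullMeasurableSet_fibreSet (ℓ : Lifting μ) (x : X) :
    NullMeasurableSet (ℓ.fibreSet x) μ := by
  unfold Lifting.fibreSet
  split_ifs with h1 h2
  · exact h1
  · exact ℓ.nullMeasurable _ h2.choose_spec.1.1
  · exact nullMeasurableSet_empty

section Fibres

variable (ℓ : Lifting μ) {L : Type*} [AddCommGroup L] [Module (BddFun μ) L]
  [Module ℝ L] [IsScalarTower ℝ (BddFun μ) L]

variable (L) in
/-- The fibre at `x` of the module `L`: all multiples `𝟙_S • v`, `S` being the set `{x}` or the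
lifted atom containing `x`. It carries the (semi)norm `u ↦ |u|(x)`. -/
noncomputable def Fibre (x : X) : Submodule ℝ L where
  carrier := range fun v : L => barInd μ (ℓ.fibreSet x) (ℓ.nullMeasurableSet_fibreSet x) • v
  add_mem' := by
    rintro _ _ ⟨v, rfl⟩ ⟨w, rfl⟩
    exact ⟨v + w, smul_add _ _ _⟩
  zero_mem' := ⟨0, smul_zero _⟩
  smul_mem' := by
    rintro c _ ⟨v, rfl⟩
    exact ⟨c • v, (smul_comm _ _ _).symm⟩

/-- The value `v_x = 𝟙_S • v` of `v` at `x`. -/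
noncomputable def valueAt (v : L) (x : X) : Fibre ℓ L x :=
  ⟨barInd μ (ℓ.fibreSet x) (ℓ.nullMeasurableSet_fibreSet x) • v, v, rfl⟩

variable {nL : L → BddFun μ}

/-- The dual of the fibre at `x`: the linear functionals that are continuous, i.e. bounded, with
respect to the (semi)norm `u ↦ |u|(x)` of the fibre. -/
def FibreDual (nL : L → BddFun μ) (x : X) : Submodule ℝ (Fibre ℓ L x →ₗ[ℝ] ℝ) where
  carrier := {φ | ∃ C, ∀ u : Fibre ℓ L x, |φ u| ≤ C * (nL u : X → ℝ) x}
  add_mem' := by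
    rintro φ ψ ⟨C, hC⟩ ⟨D, hD⟩
    refine ⟨C + D, fun u => (abs_add_le _ _).trans ?_⟩
    rw [add_mul]
    exact add_le_add (hC u) (hD u)
  zero_mem' := ⟨0, fun u => by simp⟩
  smul_mem' := by
    rintro c φ ⟨C, hC⟩
    refine ⟨|c| * C, fun u => ?_⟩
    rw [LinearMap.smul_apply, smul_eq_mul, abs_mul, mul_assoc]
    exact mul_le_mul_of_nonneg_left (hC u) (abs_nonneg c)

/-- Sections of the bundle of duals of the fibres. -/
def DualSection (nL : L → BddFun μ) : Type _ := ∀ x, FibreDual ℓ nL x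

noncomputable instance : AddCommGroup (DualSection ℓ nL) :=
  inferInstanceAs (AddCommGroup (∀ x, FibreDual ℓ nL x))

noncomputable instance : Module ℝ (DualSection ℓ nL) :=
  inferInstanceAs (Module ℝ (∀ x, FibreDual ℓ nL x))

variable {ℓ}

/-- Finite combinations `∑ᵢ fᵢ vᵢ` of test vectors `x ↦ (vᵢ)_x`, `vᵢ ∈ L`, with `Σ̄`-measurable
coefficients `fᵢ : X → ℝ`. -/
def IsTestCombination (s : ∀ x, Fibre ℓ L x) : Prop :=
  ∃ (n : ℕ) (f : Fin n → X → ℝ) (v : Fin n → L), (∀ i, NullMeasurable (f i) μ) ∧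
    ∀ x, s x = ∑ i, f i x • valueAt ℓ (v i) x

/-- Weakly measurable sections: the coupling with any test vector `x ↦ v_x`, `v ∈ L`, agrees with
a measurable function off a negligible set. -/
def WeaklyMeasurable (w : DualSection ℓ nL) : Prop :=
  ∀ v : L, AEMeasurable (fun x => (w x).1 (valueAt ℓ v x)) μ

/-- The section `w` is equivalent to zero: its coupling with any test vector vanishes almost
everywhere, with an exceptional set that may depend on the test vector. -/
def WeaklyNull (w : DualSection ℓ nL) : Prop :=
  ∀ v : L, ∀ᵐ x ∂μ, (w x).1 (valueAt ℓ v x) = 0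

/-- Combinations of test vectors with norm at most one at every point. -/
def IsUnitTest (nL : L → BddFun μ) (s : ∀ x, Fibre ℓ L x) : Prop :=
  IsTestCombination s ∧ ∀ x, (nL (s x) : X → ℝ) x ≤ 1

end Fibres

/-! ### The space `L^∞_weak` -/

section Weak

set_option linter.unusedSectionVars false

variable [SigmaFinite μ] {ℓ : Lifting μ} {L : Type*} [AddCommGroup L] [Module (BddFun μ) L]
  [Module ℝ L] [IsScalarTower ℝ (BddFun μ) L] {nL : L → BddFun μ}

/-- The pointwise norm `|w|` of a section: the essential supremum of the couplings `⟨w, s⟩` over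
all `s` of norm at most one. As `s = 0` is admitted, taking positive parts changes nothing. -/
noncomputable def sectionNorm (w : DualSection ℓ nL) : X →ₘ[μ] ℝ≥0∞ :=
  essSupSet {g | ∃ s, IsUnitTest nL s ∧ g =ᵐ[μ] fun x => ENNReal.ofReal ((w x).1 (s x))}

theorem WeaklyMeasurable.aemeasurable {w : DualSection ℓ nL} (hw : WeaklyMeasurable w)
    {s : ∀ x, Fibre ℓ L x} (hs : IsTestCombination s) :
    AEMeasurable (fun x => (w x).1 (s x)) μ := by
  obtain ⟨n, f, v, hf, hs⟩ := hs
  have : (fun x => (w x).1 (s x)) = fun x => ∑ i, f i x * (w x).1 (valueAt ℓ (v i) x) := by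
    funext x
    rw [hs x, map_sum]
    simp
  rw [this]
  exact Finset.aemeasurable_fun_sum _ fun i _ => AEMeasurable.mul (hf i).aemeasurable (hw (v i))

theorem WeaklyNull.pairing_eq_zero {w : DualSection ℓ nL} (hw : WeaklyNull w)
    {s : ∀ x, Fibre ℓ L x} (hs : IsTestCombination s) : ∀ᵐ x ∂μ, (w x).1 (s x) = 0 := by
  obtain ⟨n, f, v, hf, hs⟩ := hs
  filter_upwards [ae_all_iff.2 fun i => hw (v i)] with x hx
  rw [hs x, map_sum]
  exact Finset.sum_eq_zero fun i _ => by rw [map_smul, hx i, smul_zero]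

theorem IsUnitTest.neg (hL : IsBarNormedModule nL) {s : ∀ x, Fibre ℓ L x} (hs : IsUnitTest nL s) :
    IsUnitTest nL fun x => -s x := by
  obtain ⟨⟨n, f, v, hf, h⟩, h1⟩ := hs
  refine ⟨⟨n, fun i x => -f i x, v, fun i => Measurable.neg (α := NullMeasurableSpace X μ) (hf i),
    fun x => by simp only [h x, neg_smul, Finset.sum_neg_distrib]⟩,
    fun x => ?_⟩
  have := hL.smul (-1) (s x : L) x
  rw [neg_one_smul] at this
  have h2 : |((-1 : BddFun μ) : X → ℝ) x| = 1 := by simp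
  rw [h2, one_mul] at this
  simpa [this] using h1 x

/-- The pointwise norm of `w` is in `L^∞(μ)`. -/
def EssBounded (w : DualSection ℓ nL) : Prop :=
  ∃ C : ℝ, ∀ᵐ x ∂μ, sectionNorm w x ≤ ENNReal.ofReal C

theorem EssBounded.of_le {w : DualSection ℓ nL} (C : ℝ)
    (h : ∀ s, IsUnitTest nL s → ∀ᵐ x ∂μ, (w x).1 (s x) ≤ C) : EssBounded w := by
  refine ⟨C, essSupSet_le ?_⟩
  rintro g ⟨s, hs, hg⟩
  filter_upwards [hg, h s hs] with x h1 h2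
  rw [h1]
  exact ENNReal.ofReal_le_ofReal h2

theorem EssBounded.exists_abs_le (hL : IsBarNormedModule nL) {w : DualSection ℓ nL}
    (hw : WeaklyMeasurable w) (hb : EssBounded w) :
    ∃ C : ℝ, 0 ≤ C ∧ ∀ s, IsUnitTest nL s → ∀ᵐ x ∂μ, |(w x).1 (s x)| ≤ C := by
  obtain ⟨C, hC⟩ := hb
  have key : ∀ s, IsUnitTest nL s → ∀ᵐ x ∂μ, (w x).1 (s x) ≤ max C 0 := fun s hs => by
    have hm : AEStronglyMeasurable (fun x => ENNReal.ofReal ((w x).1 (s x))) μ :=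
      (hw.aemeasurable hs.1).ennreal_ofReal.aestronglyMeasurable
    have h1 : AEEqFun.mk _ hm ≤ sectionNorm w :=
      (isLUB_essSupSet _).1 ⟨s, hs, AEEqFun.coeFn_mk _ hm⟩
    filter_upwards [AEEqFun.coeFn_le.2 h1, AEEqFun.coeFn_mk _ hm, hC] with x h2 h3 h4
    rw [h3] at h2
    have h5 := h2.trans h4
    by_contra hlt
    push Not at hlt
    have h6 := (ENNReal.ofReal_le_ofReal_iff' (p := (w x).1 (s x)) (q := C)).1 h5
    rcases h6 with h6 | h6
    · exact absurd (h6.trans (le_max_left C 0)) (not_le.2 hlt)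
    · exact absurd (h6.trans (le_max_right C 0)) (not_le.2 hlt)
  refine ⟨max C 0, le_max_right _ _, fun s hs => ?_⟩
  filter_upwards [key s hs, key _ (hs.neg hL)] with x h1 h2
  have h3 : (w x).1 (-s x) = -(w x).1 (s x) := map_neg _ _
  rw [h3] at h2
  exact abs_le.2 ⟨by linarith, h1⟩

variable (ℓ) in
/-- The weakly measurable sections `w` with `|w| ∈ L^∞(μ)`. -/
noncomputable def bddWeakSections (hL : IsBarNormedModule nL) : Submodule ℝ (DualSection ℓ nL) where
  carrier := {w | WeaklyMeasurable w ∧ EssBounded w}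
  add_mem' := by
    rintro w z ⟨hw, hwb⟩ ⟨hz, hzb⟩
    refine ⟨fun v => (hw v).add (hz v), ?_⟩
    obtain ⟨C, -, hC⟩ := hwb.exists_abs_le hL hw
    obtain ⟨D, -, hD⟩ := hzb.exists_abs_le hL hz
    refine .of_le (C + D) fun s hs => ?_
    filter_upwards [hC s hs, hD s hs] with x h1 h2
    exact add_le_add (le_of_abs_le h1) (le_of_abs_le h2)
  zero_mem' := ⟨fun v => aemeasurable_const (b := (0 : ℝ)),
    .of_le 0 fun s _ => ae_of_all _ fun x => le_rfl⟩
  smul_mem' := by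
    rintro c w ⟨hw, hwb⟩
    refine ⟨fun v => (hw v).const_mul c, ?_⟩
    obtain ⟨C, -, hC⟩ := hwb.exists_abs_le hL hw
    refine .of_le (|c| * C) fun s hs => ?_
    filter_upwards [hC s hs] with x h1
    refine (le_abs_self _).trans ?_
    change |c * (w x).1 (s x)| ≤ _
    rw [abs_mul]
    exact mul_le_mul_of_nonneg_left h1 (abs_nonneg c)

variable (ℓ) in
/-- The sections equivalent to zero. -/
noncomputable def nullSections (hL : IsBarNormedModule nL) : Submodule ℝ (bddWeakSections ℓ hL) where
  carrier := {w | WeaklyNull w.1}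
  add_mem' := by
    intro w z hw hz v
    filter_upwards [hw v, hz v] with x h1 h2
    change (w.1 x).1 _ + (z.1 x).1 _ = 0
    rw [h1, h2, add_zero]
  zero_mem' := fun v => ae_of_all _ fun x => rfl
  smul_mem' := by
    intro c w hw v
    filter_upwards [hw v] with x h1
    change c * (w.1 x).1 _ = 0
    rw [h1, mul_zero]

variable (ℓ) in
/-- The space `L^∞_weak` of equivalence classes of weakly measurable, essentially bounded sections
of the duals of the fibres. -/
noncomputable def LinftyWeak (hL : IsBarNormedModule nL) : Type _ := bddWeakSections ℓ hL ⧸ nullSections ℓ hL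

variable {hL : IsBarNormedModule nL}

noncomputable instance : AddCommGroup (LinftyWeak ℓ hL) :=
  inferInstanceAs (AddCommGroup (bddWeakSections ℓ hL ⧸ nullSections ℓ hL))

/-- The class of a section. -/
noncomputable def LinftyWeak.mk (w : bddWeakSections ℓ hL) : LinftyWeak ℓ hL := Submodule.Quotient.mk w

theorem LinftyWeak.mk_eq_mk {w z : bddWeakSections ℓ hL} : mk w = mk z ↔
    ∀ v : L, ∀ᵐ x ∂μ, (w.1 x).1 (valueAt ℓ v x) = (z.1 x).1 (valueAt ℓ v x) := by
  refine (Submodule.Quotient.eq _).trans (forall_congr' fun v => eventually_congr ?_)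
  exact ae_of_all _ fun x => sub_eq_zero

/-- Pointwise product of a section with a representative of `f ∈ L^∞(μ)`. -/
noncomputable def bddWeakSmul (f : Lp ℝ ∞ μ) (w : bddWeakSections ℓ hL) : bddWeakSections ℓ hL :=
  ⟨fun x => f x • w.1 x, fun v => (Lp.stronglyMeasurable f).measurable.aemeasurable.mul (w.2.1 v), by
    obtain ⟨C, hC0, hC⟩ := w.2.2.exists_abs_le hL w.2.1
    refine .of_le (‖f‖ * C) fun s hs => ?_
    filter_upwards [hC s hs, ae_abs_le_norm f] with x h1 h2
    refine (le_abs_self _).trans ?_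
    change |f x * (w.1 x).1 (s x)| ≤ _
    rw [abs_mul]
    exact mul_le_mul h2 h1 (abs_nonneg _) (norm_nonneg f)⟩

noncomputable instance : SMul (Lp ℝ ∞ μ) (LinftyWeak ℓ hL) where
  smul f := Quotient.lift (fun w => LinftyWeak.mk (bddWeakSmul f w)) fun w z h => by
    have h : LinftyWeak.mk w = LinftyWeak.mk z := Quotient.sound h
    rw [LinftyWeak.mk_eq_mk] at h ⊢
    intro v
    filter_upwards [h v] with x hx
    change f x * (w.1 x).1 _ = f x * (z.1 x).1 _
    rw [hx]

theorem LinftyWeak.smul_mk (f : Lp ℝ ∞ μ) (w : bddWeakSections ℓ hL) :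
    f • mk w = mk (bddWeakSmul f w) := rfl

theorem LinftyWeak.ind_mk {P : LinftyWeak ℓ hL → Prop} (h : ∀ w, P (mk w)) (q) : P q :=
  Quotient.ind h q

noncomputable instance : Module (Lp ℝ ∞ μ) (LinftyWeak ℓ hL) where
  one_smul := LinftyWeak.ind_mk fun w => by
    rw [LinftyWeak.smul_mk, LinftyWeak.mk_eq_mk]
    intro v
    filter_upwards [coeFn_one (μ := μ)] with x hx
    change (1 : Lp ℝ ∞ μ) x * (w.1 x).1 _ = _
    rw [hx, one_mul]
  mul_smul f g := LinftyWeak.ind_mk fun w => by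
    rw [LinftyWeak.smul_mk, LinftyWeak.smul_mk, LinftyWeak.smul_mk, LinftyWeak.mk_eq_mk]
    intro v
    filter_upwards [coeFn_mul f g] with x hx
    change (f * g) x * (w.1 x).1 _ = f x * (g x * (w.1 x).1 _)
    rw [hx, mul_assoc]
  smul_zero f := by
    change f • LinftyWeak.mk 0 = LinftyWeak.mk 0
    rw [LinftyWeak.smul_mk, LinftyWeak.mk_eq_mk]
    exact fun v => ae_of_all _ fun x => mul_zero (f x)
  smul_add f := LinftyWeak.ind_mk fun w => LinftyWeak.ind_mk fun z => by
    change LinftyWeak.mk (bddWeakSmul f (w + z)) =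
      LinftyWeak.mk (bddWeakSmul f w + bddWeakSmul f z)
    rw [LinftyWeak.mk_eq_mk]
    exact fun v => ae_of_all _ fun x => mul_add (f x) _ _
  add_smul f g := LinftyWeak.ind_mk fun w => by
    change LinftyWeak.mk (bddWeakSmul (f + g) w) =
      LinftyWeak.mk (bddWeakSmul f w + bddWeakSmul g w)
    rw [LinftyWeak.mk_eq_mk]
    intro v
    filter_upwards [Lp.coeFn_add f g] with x hx
    change (f + g : Lp ℝ ∞ μ) x * (w.1 x).1 _ = f x * (w.1 x).1 _ + g x * (w.1 x).1 _
    rw [hx, Pi.add_apply, add_mul]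
  zero_smul := LinftyWeak.ind_mk fun w => by
    change LinftyWeak.mk (bddWeakSmul 0 w) = LinftyWeak.mk 0
    rw [LinftyWeak.mk_eq_mk]
    intro v
    filter_upwards [Lp.coeFn_zero ℝ ∞ μ] with x hx
    have h3 : (0 : Lp ℝ ∞ μ) x = 0 := hx
    change (0 : Lp ℝ ∞ μ) x * (w.1 x).1 _ = 0
    rw [h3, zero_mul]

/-- The pointwise norm on `L^∞_weak`. -/
noncomputable def LinftyWeak.norm : LinftyWeak ℓ hL → Lp ℝ ∞ μ :=
  Quotient.lift (fun w => toLinfty (sectionNorm w.1) w.2.2) fun w z h => by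
    have h : LinftyWeak.mk w = LinftyWeak.mk z := Quotient.sound h
    have h0 : WeaklyNull (w - z).1 := (Submodule.Quotient.eq _).1 h
    suffices sectionNorm w.1 = sectionNorm z.1 by simp only [this]
    unfold sectionNorm
    congr 1
    ext g
    refine exists_congr fun s => and_congr_right fun hs => ?_
    have h1 : (fun x => ENNReal.ofReal ((w.1 x).1 (s x))) =ᵐ[μ]
        fun x => ENNReal.ofReal ((z.1 x).1 (s x)) := by
      filter_upwards [h0.pairing_eq_zero hs.1] with x hx
      rw [sub_eq_zero.1 hx]
    exact ⟨fun h => h.trans h1, fun h => h.trans h1.symm⟩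

end Weak

/-! ### The dual module -/

section Dual

variable {M : Type*} [AddCommGroup M] [Module (Lp ℝ ∞ μ) M] (nM : M → Lp ℝ ∞ μ)

/-- The module dual `M*`: the continuous, i.e. bounded, `L^∞(μ)`-linear maps `M → L^∞(μ)`. -/
def DualModule : Submodule (Lp ℝ ∞ μ) (M →ₗ[Lp ℝ ∞ μ] Lp ℝ ∞ μ) where
  carrier := {T | ∃ C, ∀ v, ‖T v‖ ≤ C * ‖nM v‖}
  add_mem' := by
    rintro S T ⟨C, hC⟩ ⟨D, hD⟩
    refine ⟨C + D, fun v => (norm_add_le _ _).trans ?_⟩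
    rw [add_mul]
    exact add_le_add (hC v) (hD v)
  zero_mem' := ⟨0, fun v => by simp⟩
  smul_mem' := by
    rintro f T ⟨C, hC⟩
    refine ⟨‖f‖ * C, fun v => (norm_mul_le' f (T v)).trans ?_⟩
    rw [mul_assoc]
    exact mul_le_mul_of_nonneg_left (hC v) (norm_nonneg f)

variable {nM} in
/-- The pointwise norm `|T| = ess sup {|T v| : ‖v‖ ≤ 1}` on `M*`. -/
noncomputable def DualModule.norm [SigmaFinite μ] (T : DualModule nM) : Lp ℝ ∞ μ :=
  toLinfty (essSupSet {g | ∃ v, ‖nM v‖ ≤ 1 ∧ g =ᵐ[μ] fun x => ENNReal.ofReal |T.1 v x|}) <| by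
    obtain ⟨C, hC⟩ := T.2
    refine ⟨max C 0, essSupSet_le ?_⟩
    rintro g ⟨v, hv, hg⟩
    filter_upwards [hg, ae_abs_le_norm (T.1 v)] with x h1 h2
    rw [h1]
    refine ENNReal.ofReal_le_ofReal (h2.trans ((hC v).trans ?_))
    calc C * ‖nM v‖ ≤ max C 0 * ‖nM v‖ :=
          mul_le_mul_of_nonneg_right (le_max_left _ _) (norm_nonneg _)
      _ ≤ max C 0 * 1 := mul_le_mul_of_nonneg_left hv (le_max_right _ _)
      _ = max C 0 := mul_one _

end Dual

end LinftyModule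

open MeasureTheory LinftyModule
open scoped ENNReal

universe u v w

namespace LinftyModule

set_option linter.unusedSectionVars false

open MeasureTheory Filter Set
open scoped ENNReal Topology

section

/-! ### Liftings of functions -/

namespace Lifting

variable {X : Type*} [MeasurableSpace X] {μ : Measure X} (ℓ : Lifting μ)

/-! The lifting of a function is its limit at each point along a filter finer than the a.e. filter.
Identities and inequalities that hold almost everywhere in `L^∞(μ)` therefore hold at every point
after lifting. This makes it possible to evaluate a functional `T ∈ M*` at a single point.

Surjectivity. Since `|T v| ≤ |T| |v|`, the number `ℓ(T v)(x)` is bounded by `‖|T|‖ · |ℓ(v)|(x)`. It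
thus defines a bounded functional on the image of `M` in the fibre at `x`, and Hahn-Banach extends
it to the whole fibre (`exists_fibre_functional`). The extensions at different points are chosen
independently of each other, yet the section is weakly measurable. By
`IsModuleLifting.exists_approx`, every `u` in the lifted module is a uniform limit of lifted vectors
patched along countable partitions. The extensions have a common bound, so the coupling with `u` is
a pointwise limit of patched functions `ℓ(T v)` (`LinftyWeak.toDual_surjective`).

Injectivity and the norm. An a.e. bound for the couplings with lifted vectors passes to all vectors
of the lifted module, because each one involves only countably many lifted vectors and hence
countably many exceptional sets (`IsModuleLifting.abs_le_of_lift`). It then passes to test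
combinations, since truncating the coefficients turns such a combination, point by point, into one
of countably many module elements (`IsTestCombination.abs_le`). The bound zero gives injectivity,
and the bound `|T|` gives equality of the norms.

The dual is shown directly to be a normed module (`DualModule.isNormedModule`), and the space of
sections inherits the structure through the isomorphism. A lifting of `M` is realized by bounded
sections of the bundle of completions of `M` for the seminorms `v ↦ ℓ(|v|)(x)`, restricted to
uniform limits of patched sections (`LiftedModule.isModuleLifting`). -/

theorem limFun_mul (f g : Lp ℝ ∞ μ) (x : X) :
    ℓ.limFun (f * g) x = ℓ.limFun f x * ℓ.limFun g x :=
  limFun_eq_of_ae (coeFn_mul f g) ((ℓ.tendsto_limFun f x).mul (ℓ.tendsto_limFun g x))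

theorem limFun_abs (f : Lp ℝ ∞ μ) (x : X) : ℓ.limFun |f| x = |ℓ.limFun f x| :=
  limFun_eq_of_ae (Lp.coeFn_abs f) (ℓ.tendsto_limFun f x).abs

theorem limFun_le_of_ae {f g : Lp ℝ ∞ μ} (h : ∀ᵐ x ∂μ, f x ≤ g x) (x : X) :
    ℓ.limFun f x ≤ ℓ.limFun g x :=
  le_of_tendsto_of_tendsto (ℓ.tendsto_limFun f x) (ℓ.tendsto_limFun g x) (ℓ.filter_le_ae x h)

theorem limFun_mono {f g : Lp ℝ ∞ μ} (h : f ≤ g) (x : X) : ℓ.limFun f x ≤ ℓ.limFun g x :=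
  ℓ.limFun_le_of_ae ((Lp.coeFn_le f g).2 h) x

theorem limFun_add (f g : Lp ℝ ∞ μ) (x : X) :
    ℓ.limFun (f + g) x = ℓ.limFun f x + ℓ.limFun g x :=
  limFun_eq_of_ae (Lp.coeFn_add f g) ((ℓ.tendsto_limFun f x).add (ℓ.tendsto_limFun g x))

theorem limFun_sub (f g : Lp ℝ ∞ μ) (x : X) :
    ℓ.limFun (f - g) x = ℓ.limFun f x - ℓ.limFun g x :=
  limFun_eq_of_ae (Lp.coeFn_sub f g) ((ℓ.tendsto_limFun f x).sub (ℓ.tendsto_limFun g x))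

theorem limFun_smul (c : ℝ) (f : Lp ℝ ∞ μ) (x : X) :
    ℓ.limFun (c • f) x = c * ℓ.limFun f x :=
  limFun_eq_of_ae (Lp.coeFn_smul c f) ((ℓ.tendsto_limFun f x).const_mul c)

theorem limFun_one (x : X) : ℓ.limFun 1 x = 1 :=
  limFun_eq_of_ae coeFn_one tendsto_const_nhds

theorem limFun_zero (x : X) : ℓ.limFun 0 x = 0 :=
  limFun_eq_of_ae (Lp.coeFn_zero ℝ ∞ μ) tendsto_const_nhds

theorem limFun_nonneg {f : Lp ℝ ∞ μ} (h : 0 ≤ f) (x : X) : 0 ≤ ℓ.limFun f x := by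
  simpa [ℓ.limFun_zero x] using ℓ.limFun_mono h x

theorem nullMeasurable_limFun (f : Lp ℝ ∞ μ) : NullMeasurable (ℓ.limFun f) μ :=
  (ℓ.onLinfty f).2.1

end Lifting

variable {X : Type*} [MeasurableSpace X] {μ : Measure X}

/-! ### Patching functions along countable partitions. -/

theorem coeFn_nonneg {f : Lp ℝ ∞ μ} : (∀ᵐ x ∂μ, 0 ≤ f x) ↔ 0 ≤ f := by
  rw [← Lp.coeFn_le]
  refine eventually_congr ?_
  filter_upwards [Lp.coeFn_zero ℝ ∞ μ] with x hx
  rw [hx]; rfl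

theorem coeFn_ind (E : Set X) (hE : MeasurableSet E) :
    ⇑(ind μ E hE) =ᵐ[μ] E.indicator fun _ => 1 := MemLp.coeFn_toLp _

/-- A countable family of measurable functions, patched along a measurable index. -/
theorem nullMeasurable_patch {idx : X → ℕ} (hidx : NullMeasurable idx μ) {β : Type*}
    [MeasurableSpace β] {F : ℕ → X → β} (hF : ∀ n, NullMeasurable (F n) μ) :
    NullMeasurable (fun x => F (idx x) x) μ := by
  intro s hs
  have : (fun x => F (idx x) x) ⁻¹' s = ⋃ n, idx ⁻¹' {n} ∩ F n ⁻¹' s := by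
    ext x; simp
  rw [this]
  exact .iUnion fun n => (hidx (measurableSet_singleton n)).inter (hF n hs)

theorem measurable_patch {idx : X → ℕ} (hidx : Measurable idx) {β : Type*}
    [MeasurableSpace β] {F : ℕ → X → β} (hF : ∀ n, Measurable (F n)) :
    Measurable (fun x => F (idx x) x) := by
  intro s hs
  have : (fun x => F (idx x) x) ⁻¹' s = ⋃ n, idx ⁻¹' {n} ∩ F n ⁻¹' s := by
    ext x; simp
  rw [this]
  exact .iUnion fun n => (hidx (measurableSet_singleton n)).inter (hF n hs)

theorem exists_index {E : ℕ → Set X} (hd : Pairwise (Function.onFun Disjoint E))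
    (hu : ⋃ n, E n = univ) : ∃ idx : X → ℕ, ∀ n, idx ⁻¹' {n} = E n := by
  have h : ∀ x, ∃ n, x ∈ E n := fun x => mem_iUnion.1 (hu ▸ mem_univ x)
  choose idx hidx using h
  refine ⟨idx, fun n => ?_⟩
  ext x
  refine ⟨?_, fun hx => ?_⟩
  · rintro rfl; exact hidx x
  · by_contra hne
    exact disjoint_left.1 (hd hne) (hidx x) hx

/-- The σ-algebra is bound anew so that the same statement serves both `Σ` and its completion. -/
theorem measurable_index {_ : MeasurableSpace X} {E : ℕ → Set X} (hE : ∀ n, MeasurableSet (E n))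
    {idx : X → ℕ} (h : ∀ n, idx ⁻¹' {n} = E n) : Measurable idx :=
  measurable_to_countable' fun n => h n ▸ hE n

theorem nullMeasurable_index {E : ℕ → Set X} (hE : ∀ n, NullMeasurableSet (E n) μ)
    {idx : X → ℕ} (h : ∀ n, idx ⁻¹' {n} = E n) : NullMeasurable idx μ :=
  measurable_index (X := NullMeasurableSpace X μ) hE h

/-! ### Modules over `𝓛^∞(Σ̄)` -/

/-- If `{x}` is not in `Σ̄`, its measurable hull `A` is an atom. It is not null, as otherwise `{x}`
would be null. For measurable `B`, σ-finiteness gives `μ (A ∩ B) = μ ({x} ∩ B)`, and `{x}` misses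
`B` or its complement. Moreover `x ∈ ℓ A`, since otherwise `{x}` would lie in the null set `A ∆ ℓ
A`. So the default value `∅` of the fibre set never occurs. -/
theorem Lifting.mem_fibreSet [SigmaFinite μ] (ℓ : Lifting μ) (x : X) : x ∈ ℓ.fibreSet x := by
  unfold Lifting.fibreSet
  split_ifs with h1 h2
  · rfl
  · exact h2.choose_spec.2
  · exfalso
    refine h2 ⟨toMeasurable μ {x}, ⟨measurableSet_toMeasurable _ _, fun h0 => h1 ?_, ?_⟩, ?_⟩
    · rw [measure_toMeasurable] at h0
      exact NullMeasurableSet.of_null h0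
    · intro B hB hBm
      by_cases hx : x ∈ B
      · right
        have h3 := Measure.measure_toMeasurable_inter_of_sFinite (μ := μ) hBm.compl {x}
        rw [sdiff_eq, h3]
        have : ({x} : Set X) ∩ Bᶜ = ∅ := by
          ext y; simp; rintro rfl; exact hx
        rw [this, measure_empty]
      · left
        have h3 := Measure.measure_toMeasurable_inter_of_sFinite (μ := μ) hBm {x}
        rw [inter_eq_self_of_subset_right hB] at h3
        rw [h3]
        have : ({x} : Set X) ∩ B = ∅ := by
          ext y; simp; rintro rfl; exact hx
        rw [this, measure_empty]
    · by_contra hx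
      refine h1 (NullMeasurableSet.of_null (measure_mono_null ?_
        (ℓ.symmDiff_null _ (measurableSet_toMeasurable μ {x}))))
      rintro y rfl
      exact Or.inl ⟨subset_toMeasurable μ {y} rfl, hx⟩

section BarModule

variable {ℓ : Lifting μ} {L : Type*} [AddCommGroup L] [Module (BddFun μ) L]
  [Module ℝ L] [IsScalarTower ℝ (BddFun μ) L] {nL : L → BddFun μ}

namespace IsBarNormedModule

variable (hL : IsBarNormedModule nL)
include hL

theorem norm_smul_real (c : ℝ) (u : L) (x : X) :
    (nL (c • u) : X → ℝ) x = |c| * (nL u : X → ℝ) x := by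
  rw [← algebraMap_smul (BddFun μ) c u, hL.smul]
  rfl

theorem norm_zero (x : X) : (nL (0 : L) : X → ℝ) x = 0 := by
  rw [(hL.eq_zero_iff 0).2 rfl]; rfl

theorem norm_neg (u : L) (x : X) : (nL (-u) : X → ℝ) x = (nL u : X → ℝ) x := by
  rw [← neg_one_smul ℝ u, hL.norm_smul_real]; simp

theorem norm_sub_comm (u z : L) (x : X) : (nL (u - z) : X → ℝ) x = (nL (z - u) : X → ℝ) x := by
  rw [← neg_sub, hL.norm_neg]

theorem norm_le_add_sub (u z : L) (x : X) :
    (nL u : X → ℝ) x ≤ (nL z : X → ℝ) x + (nL (u - z) : X → ℝ) x := by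
  simpa using hL.add_le z (u - z) x

theorem norm_sub_le (u z y : L) (x : X) :
    (nL (u - y) : X → ℝ) x ≤ (nL (u - z) : X → ℝ) x + (nL (z - y) : X → ℝ) x := by
  simpa using hL.add_le (u - z) (z - y) x

theorem norm_sum_le {ι : Type*} (s : Finset ι) (u : ι → L) (x : X) :
    (nL (∑ i ∈ s, u i) : X → ℝ) x ≤ ∑ i ∈ s, (nL (u i) : X → ℝ) x := by
  classical
  induction s using Finset.induction_on with
  | empty => simp [hL.norm_zero]
  | insert a s ha ih =>
    rw [Finset.sum_insert ha, Finset.sum_insert ha]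
    exact (hL.add_le _ _ x).trans (add_le_add le_rfl ih)

/-- At `x`, multiplication by `f` is multiplication by the number `f x`. -/
theorem norm_smul_sub_smul (f : BddFun μ) (u : L) (x : X) :
    (nL (f • u - (f : X → ℝ) x • u) : X → ℝ) x = 0 := by
  rw [← algebraMap_smul (BddFun μ) ((f : X → ℝ) x) u, ← sub_smul, hL.smul]
  have : ((f - algebraMap ℝ (BddFun μ) ((f : X → ℝ) x) : BddFun μ) : X → ℝ) x = 0 :=
    sub_self ((f : X → ℝ) x)
  rw [this]; simp

end IsBarNormedModule

variable (ℓ L) in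
/-- The evaluation `v ↦ v_x` as a linear map. -/
noncomputable def evalAt (x : X) : L →ₗ[ℝ] Fibre ℓ L x where
  toFun v := valueAt ℓ v x
  map_add' v w := Subtype.ext (smul_add _ v w)
  map_smul' c v := Subtype.ext (smul_comm _ c v)

theorem evalAt_apply (x : X) (v : L) : evalAt ℓ L x v = valueAt ℓ v x := rfl

theorem norm_evalAt [SigmaFinite μ] (hL : IsBarNormedModule nL) (v : L) (x : X) :
    (nL (evalAt ℓ L x v : L) : X → ℝ) x = (nL v : X → ℝ) x := by
  refine (hL.smul _ v x).trans ?_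
  simp [barInd, ℓ.mem_fibreSet x]

namespace FibreDual

variable [SigmaFinite μ] {x : X}

theorem exists_bound (hL : IsBarNormedModule nL) (φ : FibreDual ℓ nL x) :
    ∃ C, 0 ≤ C ∧ ∀ u : L, |φ.1 (evalAt ℓ L x u)| ≤ C * (nL u : X → ℝ) x := by
  obtain ⟨C, hC⟩ := φ.2
  refine ⟨max C 0, le_max_right _ _, fun u => (hC _).trans ?_⟩
  rw [norm_evalAt hL]
  exact mul_le_mul_of_nonneg_right (le_max_left _ _) (hL.nonneg u x)

/-- A functional bounded by the seminorm does not see vectors of seminorm zero. Identities between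
values in a fibre are therefore only needed modulo such vectors. -/
theorem apply_eq (hL : IsBarNormedModule nL) (φ : FibreDual ℓ nL x) {u z : L}
    (h : (nL (u - z) : X → ℝ) x = 0) : φ.1 (evalAt ℓ L x u) = φ.1 (evalAt ℓ L x z) := by
  obtain ⟨C, -, hC⟩ := exists_bound hL φ
  have := hC (u - z)
  rw [h, mul_zero, map_sub, map_sub] at this
  exact sub_eq_zero.1 (abs_nonpos_iff.1 this)

end FibreDual

/-- A test combination is, at each point where its coefficients are at most `k`, the value of an
element of the module that depends on `k` only. -/
theorem IsTestCombination.exists_eq (hL : IsBarNormedModule nL) {s : ∀ x, Fibre ℓ L x}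
    (hs : IsTestCombination s) :
    ∃ u : ℕ → L, ∀ x, ∃ k z, s x = evalAt ℓ L x z ∧ (nL (z - u k) : X → ℝ) x = 0 := by
  obtain ⟨n, f, v, hf, hs⟩ := hs
  -- Only bounded functions act on `L`, so the coefficients are truncated to `[-k, k]`. At a given
  -- point the truncation is inactive once `k` exceeds the sum of their absolute values.
  let t : ℕ → Fin n → BddFun μ := fun k i => ⟨fun x => max (-(k : ℝ)) (min (f i x) k),
    Measurable.max (δ := NullMeasurableSpace X μ) measurable_const
      (Measurable.min (δ := NullMeasurableSpace X μ) (hf i) measurable_const), k, fun x =>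
      abs_le.2 ⟨le_max_left _ _, max_le (by linarith [k.cast_nonneg (α := ℝ)]) (min_le_right _ _)⟩⟩
  refine ⟨fun k => ∑ i, t k i • v i, fun x => ?_⟩
  obtain ⟨k, hk⟩ := exists_nat_ge (∑ i, |f i x|)
  refine ⟨k, ∑ i, f i x • v i, by simp [hs, evalAt_apply], ?_⟩
  refine le_antisymm ?_ (hL.nonneg _ x)
  rw [← Finset.sum_sub_distrib]
  refine (hL.norm_sum_le _ _ x).trans (Finset.sum_nonpos fun i _ => ?_)
  have h1 : |f i x| ≤ k :=
    (Finset.single_le_sum (f := fun i => |f i x|) (fun i _ => abs_nonneg _)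
      (Finset.mem_univ i)).trans hk
  have h2 : (t k i : X → ℝ) x = f i x := by
    change max (-(k : ℝ)) (min (f i x) k) = f i x
    rw [min_eq_left (abs_le.1 h1).2, max_eq_right (abs_le.1 h1).1]
  rw [hL.norm_sub_comm, ← h2, hL.norm_smul_sub_smul]

theorem isTestCombination_evalAt (v : L) : IsTestCombination fun x => evalAt ℓ L x v :=
  ⟨1, fun _ _ => 1, fun _ => v, fun _ => measurable_const.nullMeasurable,
    fun x => by simp [evalAt_apply]⟩

theorem isUnitTest_evalAt [SigmaFinite μ] (hL : IsBarNormedModule nL) {v : L}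
    (h : ∀ x, (nL v : X → ℝ) x ≤ 1) : IsUnitTest nL fun x => evalAt ℓ L x v :=
  ⟨isTestCombination_evalAt v, fun x => (norm_evalAt hL v x).trans_le (h x)⟩

/-! ### Pointwise properties of liftings of modules. -/

namespace IsModuleLifting

variable {M : Type*} [AddCommGroup M] [Module (Lp ℝ ∞ μ) M]
  [Module ℝ M] [IsScalarTower ℝ (Lp ℝ ∞ μ) M] {nM : M → Lp ℝ ∞ μ} {lift : M →ₗ[ℝ] L}

theorem norm_lift_apply (h : IsModuleLifting ℓ nM nL lift) (v : M) (x : X) :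
    (nL (lift v) : X → ℝ) x = ℓ.limFun (nM v) x := by rw [h.norm_lift]; rfl

theorem norm_lift_ae (h : IsModuleLifting ℓ nM nL lift) (v : M) :
    (nL (lift v) : X → ℝ) =ᵐ[μ] nM v := by rw [h.norm_lift]; exact ℓ.limFun_ae_eq _

/-- The lifting of modules is compatible with products, pointwise. -/
theorem norm_lift_smul_sub (hM : IsNormedModule nM)
    (h : IsModuleLifting ℓ nM nL lift) (f : Lp ℝ ∞ μ) (v : M) (x : X) :
    (nL (lift (f • v) - ℓ.limFun f x • lift v) : X → ℝ) x = 0 := by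
  rw [← map_smul, ← map_sub, ← algebraMap_smul (Lp ℝ ∞ μ) (ℓ.limFun f x) v, ← sub_smul,
    h.norm_lift_apply, hM.smul, ℓ.limFun_mul, ℓ.limFun_abs, ℓ.limFun_sub,
    Algebra.algebraMap_eq_smul_one, ℓ.limFun_smul, ℓ.limFun_one]
  simp

/-- The elements of `L` are uniform limits of liftings patched along a countable partition. -/
theorem exists_approx (hL : IsBarNormedModule nL) (h : IsModuleLifting ℓ nM nL lift) (u : L)
    {ε : ℝ} (hε : 0 < ε) : ∃ (idx : X → ℕ) (v : ℕ → M), NullMeasurable idx μ ∧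
      ∀ x, (nL (u - lift (v (idx x))) : X → ℝ) x ≤ ε := by
  obtain ⟨g, ⟨E, hE, z, hd, hu, hz, -, hg⟩, hug⟩ := h.generates u ε hε
  obtain ⟨idx, hidx⟩ := exists_index hd hu
  choose v hv using hz
  refine ⟨idx, v, nullMeasurable_index hE hidx, fun x => ?_⟩
  have hx : x ∈ E (idx x) := by rw [← hidx]; rfl
  -- The indicator of the piece containing `x` equals one at `x`, so the glueing identity determines
  -- `g` there up to seminorm zero.
  have h0 : (nL (g - z (idx x)) : X → ℝ) x = 0 := by
    have h1 := hL.smul (barInd μ (E (idx x)) (hE _)) (g - z (idx x)) x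
    rw [smul_sub, hg, sub_self, hL.norm_zero] at h1
    simpa [barInd, hx] using h1.symm
  rw [hv]
  exact (hL.norm_sub_le u g _ x).trans (by rw [h0, add_zero]; exact hug x)

end IsModuleLifting

end BarModule

end

section

variable {X : Type*} [MeasurableSpace X] {μ : Measure X}

/-! ### The dual module is a normed module -/

theorem ofReal_toLinfty (g : X →ₘ[μ] ℝ≥0∞) (hg : ∃ C : ℝ, ∀ᵐ x ∂μ, g x ≤ ENNReal.ofReal C) :
    ∀ᵐ x ∂μ, ENNReal.ofReal (toLinfty g hg x) = g x := by
  obtain ⟨C, hC⟩ := id hg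
  have h : toLinfty g hg =ᵐ[μ] fun x => (g x).toReal := MemLp.coeFn_toLp _
  filter_upwards [h, hC] with x h1 h2
  rw [h1, ENNReal.ofReal_toReal (ne_top_of_le_ne_top ENNReal.ofReal_ne_top h2)]

theorem toLinfty_nonneg (g : X →ₘ[μ] ℝ≥0∞) (hg : ∃ C : ℝ, ∀ᵐ x ∂μ, g x ≤ ENNReal.ofReal C) :
    0 ≤ toLinfty g hg := by
  rw [← coeFn_nonneg]
  have h : toLinfty g hg =ᵐ[μ] fun x => (g x).toReal := MemLp.coeFn_toLp _
  filter_upwards [h] with x h1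
  rw [h1]
  exact ENNReal.toReal_nonneg

/-- A bounded family of elements of `L^∞(μ)`, patched along a measurable index. -/
theorem memLp_patch {idx : X → ℕ} (hidx : Measurable idx) (F : ℕ → Lp ℝ ∞ μ) {C : ℝ}
    (hC : ∀ᵐ x ∂μ, |F (idx x) x| ≤ C) : MemLp (fun x => F (idx x) x) ∞ μ :=
  memLp_top_of_bound (measurable_patch hidx
    fun n => (Lp.stronglyMeasurable (F n)).measurable).aestronglyMeasurable C hC

namespace IsNormedModule

variable {M : Type*} [AddCommGroup M] [Module (Lp ℝ ∞ μ) M] {nM : M → Lp ℝ ∞ μ}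

theorem norm_zero (hM : IsNormedModule nM) : nM 0 = 0 := (hM.eq_zero_iff 0).2 rfl

theorem coe_nonneg (hM : IsNormedModule nM) (v : M) : ∀ᵐ x ∂μ, 0 ≤ nM v x :=
  coeFn_nonneg.2 (hM.nonneg v)

theorem coe_smul (hM : IsNormedModule nM) (f : Lp ℝ ∞ μ) (v : M) :
    ∀ᵐ x ∂μ, nM (f • v) x = |f x| * nM v x := by
  rw [hM.smul]
  filter_upwards [coeFn_mul |f| (nM v), Lp.coeFn_abs f] with x h1 h2
  rw [h1, h2]

/-- An `L^∞(μ)`-normed module structure can be transported along an isometric isomorphism. -/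
theorem of_equiv {A : Type*} [AddCommGroup A] [Module (Lp ℝ ∞ μ) A] {nA : A → Lp ℝ ∞ μ}
    (hM : IsNormedModule nM) (I : A ≃ₗ[Lp ℝ ∞ μ] M) (hI : ∀ a, nM (I a) = nA a) :
    IsNormedModule nA where
  nonneg v := hI v ▸ hM.nonneg _
  eq_zero_iff v := by rw [← hI, hM.eq_zero_iff, I.map_eq_zero_iff]
  add_le v w := by rw [← hI, ← hI, ← hI, map_add]; exact hM.add_le _ _
  smul f v := by rw [← hI, ← hI, map_smul]; exact hM.smul _ _
  glue E hE hd hu v hv := by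
    obtain ⟨u, h⟩ := hM.glue E hE hd hu (fun n => I (v n)) (by simpa only [hI] using hv)
    refine ⟨I.symm u, fun n => I.injective ?_⟩
    rw [map_smul, map_smul, I.apply_symm_apply, h n]
  complete u hu := by
    obtain ⟨z, hz⟩ := hM.complete (fun n => I (u n)) (by simpa only [← map_sub, hI] using hu)
    refine ⟨I.symm z, fun ε hε => ?_⟩
    obtain ⟨N, hN⟩ := hz ε hε
    refine ⟨N, fun n hn => ?_⟩
    rw [← hI, map_sub, I.apply_symm_apply]
    exact hN n hn

end IsNormedModule

namespace DualModule

variable {M : Type*} [AddCommGroup M] [Module (Lp ℝ ∞ μ) M] {nM : M → Lp ℝ ∞ μ}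

theorem ext_ae {S T : DualModule nM} (h : ∀ v, S.1 v =ᵐ[μ] T.1 v) : S = T :=
  Subtype.ext (LinearMap.ext fun v => Lp.ext (h v))

/-- A bound on the unit ball extends by homogeneity. -/
theorem abs_apply_le_of_unit (hM : IsNormedModule nM) (T : M →ₗ[Lp ℝ ∞ μ] Lp ℝ ∞ μ) {G : X → ℝ}
    (h : ∀ v, ‖nM v‖ ≤ 1 → ∀ᵐ x ∂μ, |T v x| ≤ G x) (v : M) :
    ∀ᵐ x ∂μ, |T v x| ≤ G x * nM v x := by
  have hmeas : Measurable (nM v) := (Lp.stronglyMeasurable (nM v)).measurable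
  -- Dividing `v` by `|v|` is impossible where `|v|` vanishes or is small. The divisor `max |v| (1 /
  -- (n + 1))` has an inverse bounded by `n + 1`, and the limit in `n` recovers `|v|`.
  have key : ∀ n : ℕ, ∀ᵐ x ∂μ, |T v x| ≤ G x * max (nM v x) (1 / (n + 1)) := by
    intro n
    have hpos : ∀ x, 0 < max (nM v x) (1 / (n + 1 : ℝ)) := fun x =>
      lt_max_of_lt_right Nat.one_div_pos_of_nat
    have hmem : MemLp (fun x => (max (nM v x) (1 / (n + 1 : ℝ)))⁻¹) ∞ μ := by
      refine memLp_top_of_bound (hmeas.max measurable_const).inv.aestronglyMeasurable (n + 1)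
        (ae_of_all _ fun x => ?_)
      rw [Real.norm_of_nonneg (inv_nonneg.2 (hpos x).le), inv_le_comm₀ (hpos x) (by positivity),
        ← one_div]
      exact le_max_right _ _
    have hf := hmem.coeFn_toLp
    set f := hmem.toLp
    have h1 : ‖nM (f • v)‖ ≤ 1 := by
      refine norm_le_of_ae zero_le_one ?_
      filter_upwards [hM.coe_smul f v, hf, hM.coe_nonneg v] with x h1 h2 h3
      rw [h1, h2, abs_mul, abs_abs, abs_of_pos (inv_pos.2 (hpos x)), abs_of_nonneg h3,
        inv_mul_le_iff₀ (hpos x), mul_one]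
      exact le_max_left _ _
    filter_upwards [h _ h1, coeFn_mul f (T v), hf] with x h2 h3 h4
    rw [map_smul, smul_eq_mul, h3, h4, abs_mul, abs_of_pos (inv_pos.2 (hpos x)),
      inv_mul_le_iff₀ (hpos x), mul_comm] at h2
    exact h2
  filter_upwards [ae_all_iff.2 key, hM.coe_nonneg v] with x hx h0
  have hlim : Tendsto (fun n : ℕ => G x * max (nM v x) (1 / (n + 1 : ℝ))) atTop
      (𝓝 (G x * max (nM v x) 0)) :=
    (tendsto_const_nhds.max tendsto_one_div_add_atTop_nhds_zero_nat).const_mul _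
  rw [max_eq_left h0] at hlim
  exact ge_of_tendsto' hlim hx

variable [SigmaFinite μ]

theorem abs_apply_le_norm_of_unit (T : DualModule nM) {v : M} (hv : ‖nM v‖ ≤ 1) :
    ∀ᵐ x ∂μ, |T.1 v x| ≤ norm T x := by
  have hm : AEStronglyMeasurable (fun x => ENNReal.ofReal |T.1 v x|) μ :=
    ((Lp.stronglyMeasurable (T.1 v)).measurable.abs.ennreal_ofReal).aestronglyMeasurable
  have h1 := AEEqFun.coeFn_le.2 ((isLUB_essSupSet {g | ∃ v, ‖nM v‖ ≤ 1 ∧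
    g =ᵐ[μ] fun x => ENNReal.ofReal |T.1 v x|}).1 ⟨v, hv, AEEqFun.coeFn_mk _ hm⟩)
  filter_upwards [h1, AEEqFun.coeFn_mk _ hm, ofReal_toLinfty _ _,
    coeFn_nonneg.2 (toLinfty_nonneg _ _)] with x h2 h3 h4 h5
  rw [h3, ← h4] at h2
  exact (ENNReal.ofReal_le_ofReal_iff h5).1 h2

theorem abs_apply_le (hM : IsNormedModule nM) (T : DualModule nM) (v : M) :
    ∀ᵐ x ∂μ, |T.1 v x| ≤ norm T x * nM v x :=
  abs_apply_le_of_unit hM T.1 (fun _ hv => abs_apply_le_norm_of_unit T hv) v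

theorem norm_apply_le (hM : IsNormedModule nM) (T : DualModule nM) (v : M) :
    ‖T.1 v‖ ≤ ‖norm T‖ * ‖nM v‖ := by
  refine norm_le_of_ae (by positivity) ?_
  filter_upwards [abs_apply_le hM T v, ae_abs_le_norm (norm T), ae_abs_le_norm (nM v)]
    with x h1 h2 h3
  refine h1.trans ((le_abs_self _).trans ?_)
  rw [abs_mul]
  exact mul_le_mul h2 h3 (abs_nonneg _) (norm_nonneg _)

theorem norm_nonneg (T : DualModule nM) : 0 ≤ norm T := toLinfty_nonneg _ _

/-- This is minimality of the essential supremum. The bound may be infinite, which `norm_smul` uses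
on the zero set of the scalar. -/
theorem ofReal_norm_le (T : DualModule nM) {G : X → ℝ≥0∞} (hG : AEMeasurable G μ)
    (h : ∀ v, ‖nM v‖ ≤ 1 → ∀ᵐ x ∂μ, ENNReal.ofReal |T.1 v x| ≤ G x) :
    ∀ᵐ x ∂μ, ENNReal.ofReal (norm T x) ≤ G x := by
  have h1 := AEEqFun.coeFn_le.2 ((isLUB_essSupSet {g | ∃ v, ‖nM v‖ ≤ 1 ∧
    g =ᵐ[μ] fun x => ENNReal.ofReal |T.1 v x|}).2 (show AEEqFun.mk G hG.aestronglyMeasurable ∈ upperBounds _ by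
      rintro g ⟨v, hv, hg⟩
      rw [← AEEqFun.coeFn_le]
      filter_upwards [hg, h v hv, AEEqFun.coeFn_mk G hG.aestronglyMeasurable] with x h1 h2 h3
      rw [h1, h3]; exact h2))
  filter_upwards [h1, AEEqFun.coeFn_mk G hG.aestronglyMeasurable, ofReal_toLinfty _ _]
    with x h2 h3 h4
  rw [h3, ← h4] at h2
  exact h2

theorem norm_le (hM : IsNormedModule nM) (T : DualModule nM) {G : X → ℝ} (hG : AEMeasurable G μ)
    (h : ∀ v, ‖nM v‖ ≤ 1 → ∀ᵐ x ∂μ, |T.1 v x| ≤ G x) : ∀ᵐ x ∂μ, norm T x ≤ G x := by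
  -- The hypothesis at `v = 0` shows that `G` is nonnegative almost everywhere, so `ENNReal.ofReal`
  -- can be removed.
  filter_upwards [ofReal_norm_le T hG.ennreal_ofReal fun v hv => by
    filter_upwards [h v hv] with x hx using ENNReal.ofReal_le_ofReal hx,
    h 0 (by simp [hM.norm_zero])] with x h1 h2
  exact (ENNReal.ofReal_le_ofReal_iff ((abs_nonneg _).trans h2)).1 h1

theorem norm_add_le (hM : IsNormedModule nM) (S T : DualModule nM) :
    norm (S + T) ≤ norm S + norm T := by
  have hm : AEMeasurable (fun x => norm S x + norm T x) μ :=
    ((Lp.stronglyMeasurable (norm S)).measurable.add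
      (Lp.stronglyMeasurable (norm T)).measurable).aemeasurable
  rw [← Lp.coeFn_le]
  have key := norm_le hM (S + T) hm fun v hv => by
    filter_upwards [abs_apply_le_norm_of_unit S hv, abs_apply_le_norm_of_unit T hv,
      Lp.coeFn_add (S.1 v) (T.1 v)] with x h1 h2 h3
    have : (S + T).1 v = S.1 v + T.1 v := rfl
    rw [this, h3, Pi.add_apply]
    exact (abs_add_le _ _).trans (add_le_add h1 h2)
  filter_upwards [key, Lp.coeFn_add (norm S) (norm T)] with x h1 h2
  rw [h2]; exact h1

omit [SigmaFinite μ] in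
theorem coe_smul_apply (f : Lp ℝ ∞ μ) (T : DualModule nM) (v : M) :
    (f • T).1 v =ᵐ[μ] fun x => f x * T.1 v x := coeFn_mul f (T.1 v)

theorem norm_smul (hM : IsNormedModule nM) (f : Lp ℝ ∞ μ) (T : DualModule nM) :
    norm (f • T) = |f| * norm T := by
  have hf : Measurable f := (Lp.stronglyMeasurable f).measurable
  have hm : AEMeasurable (fun x => |f x| * norm T x) μ :=
    (hf.abs.mul (Lp.stronglyMeasurable (norm T)).measurable).aemeasurable
  have h1 := norm_le hM (f • T) hm fun v hv => by
    filter_upwards [abs_apply_le_norm_of_unit T hv, coe_smul_apply f T v] with x h1 h2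
    rw [h2, abs_mul]
    exact mul_le_mul_of_nonneg_left h1 (abs_nonneg _)
  -- For `|f| |T| ≤ |f T|`, the factor `|f|` is divided out of the bound for `f T`. Where `f = 0`
  -- nothing is known about `T`, hence the value `∞`; the desired inequality is trivial there.
  let G : X → ℝ≥0∞ := fun x => if f x = 0 then ∞ else ENNReal.ofReal (norm (f • T) x / |f x|)
  have hG : AEMeasurable G μ :=
    (Measurable.ite (hf (measurableSet_singleton 0)) measurable_const
      ((Lp.stronglyMeasurable (norm (f • T))).measurable.div hf.abs).ennreal_ofReal).aemeasurable
  have h2 := ofReal_norm_le T hG fun v hv => by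
    filter_upwards [abs_apply_le_norm_of_unit (f • T) hv, coe_smul_apply f T v] with x h1 h2
    by_cases h0 : f x = 0
    · simp [G, h0]
    · rw [h2, abs_mul] at h1
      simp only [G, h0, if_false]
      refine ENNReal.ofReal_le_ofReal ?_
      rwa [le_div_iff₀' (abs_pos.2 h0)]
  refine Lp.ext ?_
  filter_upwards [h1, h2, coeFn_mul |f| (norm T), Lp.coeFn_abs f,
    coeFn_nonneg.2 (norm_nonneg (f • T))] with x h1 h2 h3 h4 h5
  rw [h3, h4]
  refine le_antisymm h1 ?_
  by_cases h0 : f x = 0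
  · simpa [h0] using h5
  · simp only [G, h0, if_false] at h2
    rw [ENNReal.ofReal_le_ofReal_iff (by positivity), le_div_iff₀' (abs_pos.2 h0)] at h2
    exact h2

theorem norm_eq_zero_iff (hM : IsNormedModule nM) (T : DualModule nM) : norm T = 0 ↔ T = 0 := by
  constructor
  · intro h
    refine Subtype.ext (LinearMap.ext fun v => ?_)
    have := norm_apply_le hM T v
    rw [h, _root_.norm_zero, zero_mul] at this
    exact norm_le_zero_iff.1 this
  · rintro rfl
    have h : norm (0 : DualModule nM) = norm ((0 : Lp ℝ ∞ μ) • (0 : DualModule nM)) := by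
      rw [smul_zero]
    rw [h, norm_smul hM, abs_zero, zero_mul]

/-- The functionals are patched value by value, with `S v` equal to `T n v` on `E n`. The hypothesis
bounds `|T n|` only on `E n`, and no other part of `T n` enters. Linearity holds off countably many
null sets. -/
theorem exists_glue (hM : IsNormedModule nM) (E : ℕ → Set X) (hE : ∀ n, MeasurableSet (E n))
    (hd : Pairwise (Function.onFun Disjoint E)) (hu : ⋃ n, E n = univ) (T : ℕ → DualModule nM)
    {C : ℝ} (hC : ∀ n, ‖ind μ (E n) (hE n) * norm (T n)‖ ≤ C) :
    ∃ S : DualModule nM, ∀ n, ind μ (E n) (hE n) • S = ind μ (E n) (hE n) • T n := by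
  obtain ⟨idx, hidx⟩ := exists_index hd hu
  have hmi := measurable_index hE hidx
  have hmem : ∀ x, x ∈ E (idx x) := fun x => by rw [← hidx]; rfl
  have hC' : ∀ᵐ x ∂μ, norm (T (idx x)) x ≤ C := by
    have : ∀ᵐ x ∂μ, ∀ n, x ∈ E n → norm (T n) x ≤ C := ae_all_iff.2 fun n => by
      filter_upwards [ae_abs_le_norm (ind μ (E n) (hE n) * norm (T n)),
        coeFn_mul (ind μ (E n) (hE n)) (norm (T n)), coeFn_ind (E n) (hE n)] with x h1 h2 h3 hx
      rw [h2, h3, indicator_of_mem hx, one_mul] at h1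
      exact (le_abs_self _).trans (h1.trans (hC n))
    filter_upwards [this] with x hx using hx _ (hmem x)
  have hC0 : 0 ≤ C := (_root_.norm_nonneg _).trans (hC 0)
  have hb : ∀ v, ∀ᵐ x ∂μ, |(T (idx x)).1 v x| ≤ C * ‖nM v‖ := fun v => by
    filter_upwards [hC', ae_all_iff.2 fun n => abs_apply_le hM (T n) v, hM.coe_nonneg v,
      ae_abs_le_norm (nM v)] with x h1 h2 h3 h4
    exact (h2 _).trans (mul_le_mul h1 ((le_abs_self _).trans h4) h3 hC0)
  have hLp := fun v => memLp_patch hmi (fun n => (T n).1 v) (hb v)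
  have hco := fun v => (hLp v).coeFn_toLp
  let S : M →ₗ[Lp ℝ ∞ μ] Lp ℝ ∞ μ :=
    { toFun := fun v => (hLp v).toLp
      map_add' := fun v w => by
        refine Lp.ext ?_
        filter_upwards [hco (v + w), hco v, hco w, Lp.coeFn_add (hLp v).toLp (hLp w).toLp,
          ae_all_iff.2 fun n => Lp.coeFn_add ((T n).1 v) ((T n).1 w)] with x h1 h2 h3 h4 h5
        rw [h1, h4, Pi.add_apply, h2, h3, map_add, h5, Pi.add_apply]
      map_smul' := fun f v => by
        refine Lp.ext ?_
        filter_upwards [hco (f • v), hco v, coeFn_mul f (hLp v).toLp,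
          ae_all_iff.2 fun n => coeFn_mul f ((T n).1 v)] with x h1 h2 h3 h4
        rw [h1, RingHom.id_apply, smul_eq_mul, h3, h2, map_smul, smul_eq_mul, h4] }
  refine ⟨⟨S, C, fun v => norm_le_of_ae (by positivity) ?_⟩, fun n => ?_⟩
  · filter_upwards [hb v, hco v] with x h1 h2
    exact (congrArg abs h2).trans_le h1
  · refine Subtype.ext (LinearMap.ext fun v => Lp.ext ?_)
    filter_upwards [coe_smul_apply (ind μ (E n) (hE n)) (T n) v,
      coeFn_mul (ind μ (E n) (hE n)) (S v), coeFn_ind (E n) (hE n), hco v] with x h1 h2 h3 h4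
    refine h2.trans (Eq.trans ?_ h1.symm)
    rw [h3]
    by_cases hx : x ∈ E n
    · have : idx x = n := by rw [← hidx] at hx; exact hx
      have h5 : S v x = (T (idx x)).1 v x := h4
      rw [h5, this]
    · simp [hx]

/-- The limit is taken vector by vector in the complete space `L^∞(μ)`. It is `L^∞(μ)`-linear
because multiplication by a fixed element is continuous. The estimate is uniform in `v` because the
Cauchy condition concerns the norms of the functionals. -/
theorem exists_limit_apply (hM : IsNormedModule nM) (T : ℕ → DualModule nM)
    (hT : ∀ ε > 0, ∃ N, ∀ m ≥ N, ∀ n ≥ N, ‖norm (T m - T n)‖ ≤ ε) :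
    ∃ S : M →ₗ[Lp ℝ ∞ μ] Lp ℝ ∞ μ,
      ∀ ε > 0, ∃ N, ∀ n ≥ N, ∀ v, ‖(T n).1 v - S v‖ ≤ ε * ‖nM v‖ := by
  have hdist : ∀ m n v, ‖(T m).1 v - (T n).1 v‖ ≤ ‖norm (T m - T n)‖ * ‖nM v‖ :=
    fun m n v => norm_apply_le hM (T m - T n) v
  have hcau : ∀ v, CauchySeq fun n => (T n).1 v := fun v => by
    rw [Metric.cauchySeq_iff]
    intro ε hε
    obtain ⟨N, hN⟩ := hT (ε / (‖nM v‖ + 1)) (by positivity)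
    refine ⟨N, fun m hm n hn => ?_⟩
    rw [dist_eq_norm]
    refine (hdist m n v).trans_lt ((mul_le_mul_of_nonneg_right (hN m hm n hn)
      (_root_.norm_nonneg _)).trans_lt ?_)
    rw [div_mul_eq_mul_div, div_lt_iff₀ (by positivity)]
    nlinarith [_root_.norm_nonneg (nM v)]
  choose F hF using fun v => cauchySeq_tendsto_of_complete (hcau v)
  let S : M →ₗ[Lp ℝ ∞ μ] Lp ℝ ∞ μ :=
    { toFun := F
      map_add' := fun v w => tendsto_nhds_unique (hF (v + w)) <| by
        simpa only [map_add] using (hF v).add (hF w)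
      map_smul' := fun f v => tendsto_nhds_unique (hF (f • v)) <| by
        rw [tendsto_iff_norm_sub_tendsto_zero]
        refine squeeze_zero (fun n => _root_.norm_nonneg _) (g := fun n =>
          ‖f‖ * ‖(T n).1 v - F v‖) (fun n => ?_) ?_
        · rw [map_smul, RingHom.id_apply, smul_eq_mul, smul_eq_mul, ← mul_sub]
          exact norm_mul_le' _ _
        · simpa using (tendsto_iff_norm_sub_tendsto_zero.1 (hF v)).const_mul ‖f‖ }
  refine ⟨S, fun ε hε => ?_⟩
  obtain ⟨N, hN⟩ := hT ε hε
  refine ⟨N, fun n hn v => le_of_tendsto ((hF v).const_sub ((T n).1 v)).norm ?_⟩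
  filter_upwards [eventually_ge_atTop N] with m hm
  exact (hdist n m v).trans (mul_le_mul_of_nonneg_right (hN n hn m hm) (_root_.norm_nonneg _))

theorem norm_sub_apply_le (hM : IsNormedModule nM) (S T : DualModule nM) {ε : ℝ} (hε : 0 ≤ ε)
    (h : ∀ v, ‖S.1 v - T.1 v‖ ≤ ε * ‖nM v‖) : ‖norm (S - T)‖ ≤ ε := by
  have hb : ∀ v, ‖nM v‖ ≤ 1 → ∀ᵐ x ∂μ, |(S - T).1 v x| ≤ ε := by
    intro v hv
    filter_upwards [ae_abs_le_norm (S.1 v - T.1 v)] with x hx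
    exact hx.trans ((h v).trans (mul_le_of_le_one_right hε hv))
  refine norm_le_of_ae hε ?_
  filter_upwards [norm_le hM (S - T) (aemeasurable_const (b := ε)) hb,
    coeFn_nonneg.2 (norm_nonneg (S - T))] with x h1 h2
  rw [abs_of_nonneg h2]
  exact h1

theorem exists_limit (hM : IsNormedModule nM) (T : ℕ → DualModule nM)
    (hT : ∀ ε > 0, ∃ N, ∀ m ≥ N, ∀ n ≥ N, ‖norm (T m - T n)‖ ≤ ε) :
    ∃ S : DualModule nM, ∀ ε > 0, ∃ N, ∀ n ≥ N, ‖norm (T n - S)‖ ≤ ε := by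
  obtain ⟨S, hlim⟩ := exists_limit_apply hM T hT
  have hS : S ∈ DualModule nM := by
    obtain ⟨N, hN⟩ := hlim 1 one_pos
    obtain ⟨C, hC⟩ := (T N).2
    refine ⟨C + 1, fun v => ?_⟩
    have h1 : ‖S v‖ ≤ ‖(T N).1 v‖ + ‖(T N).1 v - S v‖ := norm_le_insert _ _
    linarith [hC v, hN N le_rfl v]
  refine ⟨⟨S, hS⟩, fun ε hε => ?_⟩
  obtain ⟨N, hN⟩ := hlim ε hε
  exact ⟨N, fun n hn => norm_sub_apply_le hM (T n) ⟨S, hS⟩ hε.le (hN n hn)⟩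

theorem isNormedModule (hM : IsNormedModule nM) : IsNormedModule (norm (nM := nM)) where
  nonneg := norm_nonneg
  eq_zero_iff := norm_eq_zero_iff hM
  add_le := norm_add_le hM
  smul := norm_smul hM
  glue E hE hd hu T hT := hT.elim fun _ hC => exists_glue hM E hE hd hu T hC
  complete := exists_limit hM

end DualModule

end

/-! ### Hahn-Banach, and the correspondence between sections and functionals. -/

section

/-- A form of the Hahn-Banach theorem: a functional on the source of `A` that is dominated by a
sublinear function of `A` factors through `A`. -/
theorem exists_functional_comp_eq {M E : Type*} [AddCommGroup M] [Module ℝ M] [AddCommGroup E]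
    [Module ℝ E] (A : M →ₗ[ℝ] E) (φ : M →ₗ[ℝ] ℝ) (N : E → ℝ)
    (N_hom : ∀ c : ℝ, 0 < c → ∀ u, N (c • u) = c * N u) (N_add : ∀ u z, N (u + z) ≤ N u + N z)
    (hφ : ∀ v, φ v ≤ N (A v)) :
    ∃ g : E →ₗ[ℝ] ℝ, (∀ v, g (A v) = φ v) ∧ ∀ u, g u ≤ N u := by
  have h0 : N 0 = 0 := by
    have := N_hom 2 two_pos 0
    rw [smul_zero] at this
    linarith
  have hker : LinearMap.ker A ≤ LinearMap.ker φ := fun v hv => by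
    rw [LinearMap.mem_ker] at hv ⊢
    have h1 := hφ v
    have h2 := hφ (-v)
    rw [map_neg, map_neg, hv, neg_zero, h0] at h2
    rw [hv, h0] at h1
    linarith
  let f : LinearMap.range A →ₗ[ℝ] ℝ :=
    ((LinearMap.ker A).liftQ φ hker).comp A.quotKerEquivRange.symm.toLinearMap
  have hf : ∀ v, f ⟨A v, v, rfl⟩ = φ v := fun v => by
    have h1 : A.quotKerEquivRange.symm ⟨A v, v, rfl⟩ = Submodule.Quotient.mk v := by
      rw [LinearEquiv.symm_apply_eq]; rfl
    change (LinearMap.ker A).liftQ φ hker (A.quotKerEquivRange.symm ⟨A v, v, rfl⟩) = φ v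
    rw [h1]; rfl
  obtain ⟨g, hg, hgN⟩ := exists_extension_of_le_sublinear ⟨LinearMap.range A, f⟩ N N_hom N_add <| by
    rintro ⟨_, v, rfl⟩
    exact (hf v).trans_le (hφ v)
  exact ⟨g, fun v => (hg ⟨A v, v, rfl⟩).trans (hf v), hgN⟩

variable {X : Type*} [MeasurableSpace X] {μ : Measure X} [SigmaFinite μ] {ℓ : Lifting μ}
  {L : Type*} [AddCommGroup L] [Module (BddFun μ) L]
  [Module ℝ L] [IsScalarTower ℝ (BddFun μ) L] {nL : L → BddFun μ}
  {M : Type*} [AddCommGroup M] [Module (Lp ℝ ∞ μ) M]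
  [Module ℝ M] [IsScalarTower ℝ (Lp ℝ ∞ μ) M] {nM : M → Lp ℝ ∞ μ} {lift : M →ₗ[ℝ] L}

/-! ### Estimates for sections of the dual bundle -/

/-- Uniform bounds for the couplings of an essentially bounded section. -/
theorem EssBounded.exists_abs_le_mul (hL : IsBarNormedModule nL) {w : DualSection ℓ nL}
    (hw : WeaklyMeasurable w) (hb : EssBounded w) :
    ∃ C : ℝ, 0 ≤ C ∧ ∀ (u : L) (B : ℝ), (∀ x, (nL u : X → ℝ) x ≤ B) →
      ∀ᵐ x ∂μ, |(w x).1 (evalAt ℓ L x u)| ≤ C * B := by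
  obtain ⟨C, hC0, hC⟩ := hb.exists_abs_le hL hw
  refine ⟨C, hC0, fun u B hB => ?_⟩
  rcases lt_or_ge 0 B with hB0 | hB0
  · have hu : ∀ x, (nL (B⁻¹ • u) : X → ℝ) x ≤ 1 := fun x => by
      rw [hL.norm_smul_real, abs_of_pos (inv_pos.2 hB0), inv_mul_le_iff₀ hB0, mul_one]
      exact hB x
    filter_upwards [hC _ (isUnitTest_evalAt hL hu)] with x hx
    rw [map_smul, map_smul, smul_eq_mul, abs_mul, abs_of_pos (inv_pos.2 hB0),
      inv_mul_le_iff₀ hB0, mul_comm] at hx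
    exact hx
  -- As soon as there is a point, `B ≥ 0`, so here `B = 0` and `u` has seminorm zero at every point.
  · refine ae_of_all _ fun x => ?_
    have h0 : B = 0 := le_antisymm hB0 ((hL.nonneg u x).trans (hB x))
    have h1 : (nL (u - 0) : X → ℝ) x = 0 := by
      rw [sub_zero]
      exact le_antisymm (h0 ▸ hB x) (hL.nonneg u x)
    rw [FibreDual.apply_eq hL (w x) h1, map_zero, map_zero, abs_zero, h0, mul_zero]

/-- Pointwise bounds on the lifted vectors extend to the whole module. -/
theorem IsModuleLifting.abs_le_of_lift (h : IsModuleLifting ℓ nM nL lift)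
    (hL : IsBarNormedModule nL) {w : DualSection ℓ nL} {G : X → ℝ}
    (hG : ∀ v, ∀ᵐ x ∂μ, |(w x).1 (evalAt ℓ L x (lift v))| ≤ G x * (nL (lift v) : X → ℝ) x)
    (u : L) : ∀ᵐ x ∂μ, |(w x).1 (evalAt ℓ L x u)| ≤ G x * (nL u : X → ℝ) x := by
  choose idx v _ hv using fun k : ℕ =>
    h.exists_approx hL u (Nat.one_div_pos_of_nat (α := ℝ) (n := k))
  -- Countably many lifted vectors suffice for all the approximations of `u`. Off a single null set
  -- the bound holds for each of them, and the continuity constant `C` below may then depend on `x`.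
  filter_upwards [ae_all_iff.2 fun k => ae_all_iff.2 fun n => hG (v k n)] with x hx
  obtain ⟨C, hC0, hC⟩ := FibreDual.exists_bound hL (w x)
  have key : ∀ k : ℕ, |(w x).1 (evalAt ℓ L x u)| ≤
      G x * (nL u : X → ℝ) x + (C + |G x|) * (1 / (k + 1)) := by
    intro k
    have h1 := hv k x
    have h2 := hx k (idx k x)
    set z := lift (v k (idx k x))
    have h3 := (hC (u - z)).trans (mul_le_mul_of_nonneg_left h1 hC0)
    rw [map_sub, map_sub] at h3
    have h4 : |(nL z : X → ℝ) x - (nL u : X → ℝ) x| ≤ 1 / (k + 1) := by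
      rw [abs_le]
      have h5 := hL.norm_le_add_sub u z x
      have h6 := hL.norm_le_add_sub z u x
      rw [hL.norm_sub_comm] at h6
      constructor <;> linarith
    have h5 : G x * (nL z : X → ℝ) x ≤ G x * (nL u : X → ℝ) x + |G x| * (1 / (k + 1)) := by
      have : G x * ((nL z : X → ℝ) x - (nL u : X → ℝ) x) ≤ |G x| * (1 / (k + 1)) := by
        refine (le_abs_self _).trans ?_
        rw [abs_mul]
        exact mul_le_mul_of_nonneg_left h4 (abs_nonneg _)
      linarith
    have h6 := abs_sub_abs_le_abs_sub ((w x).1 (evalAt ℓ L x u)) ((w x).1 (evalAt ℓ L x z))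
    linarith
  have hlim := (tendsto_one_div_add_atTop_nhds_zero_nat (𝕜 := ℝ)).const_mul (C + |G x|)
    |>.const_add (G x * (nL u : X → ℝ) x)
  rw [mul_zero, add_zero] at hlim
  exact ge_of_tendsto' hlim key

/-- By `IsTestCombination.exists_eq`, each value of `s` is, up to seminorm zero, the value of one of
countably many elements of `L`, so the union of the exceptional sets is null. -/
theorem IsTestCombination.abs_le (hL : IsBarNormedModule nL) {w : DualSection ℓ nL} {G : X → ℝ}
    (hG : ∀ u : L, ∀ᵐ x ∂μ, |(w x).1 (evalAt ℓ L x u)| ≤ G x * (nL u : X → ℝ) x)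
    {s : ∀ x, Fibre ℓ L x} (hs : IsTestCombination s) :
    ∀ᵐ x ∂μ, |(w x).1 (s x)| ≤ G x * (nL (s x) : X → ℝ) x := by
  obtain ⟨u, hu⟩ := hs.exists_eq hL
  filter_upwards [ae_all_iff.2 fun k => hG (u k)] with x hx
  obtain ⟨k, z, h1, h2⟩ := hu x
  have h3 : (nL z : X → ℝ) x = (nL (u k) : X → ℝ) x := by
    have h4 := hL.norm_le_add_sub z (u k) x
    have h5 := hL.norm_le_add_sub (u k) z x
    rw [hL.norm_sub_comm] at h5
    rw [h2] at h4 h5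
    linarith
  rw [h1, norm_evalAt hL, h3, FibreDual.apply_eq hL (w x) h2]
  exact hx k

/-! ### The map from sections to the dual module -/

theorem memLp_pairing (hL : IsBarNormedModule nL) (h : IsModuleLifting ℓ nM nL lift)
    (w : bddWeakSections ℓ hL) (v : M) :
    MemLp (fun x => (w.1 x).1 (evalAt ℓ L x (lift v))) ∞ μ := by
  obtain ⟨C, -, hC⟩ := w.2.2.exists_abs_le_mul hL w.2.1
  refine memLp_top_of_bound (w.2.1 (lift v)).aestronglyMeasurable (C * ‖nM v‖) (hC _ _ fun x => ?_)
  rw [h.norm_lift_apply]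
  exact (le_abs_self _).trans (ℓ.abs_limFun_le _ x)

/-- The functional `v ↦ ⟨w, ℓ(v)⟩` of a section `w`. -/
noncomputable def sectionFunctional (hM : IsNormedModule nM) {hL : IsBarNormedModule nL}
    (h : IsModuleLifting ℓ nM nL lift) (w : bddWeakSections ℓ hL) : DualModule nM where
  val :=
    { toFun := fun v => (memLp_pairing hL h w v).toLp
      map_add' := fun v z => by
        refine Lp.ext ?_
        filter_upwards [(memLp_pairing hL h w (v + z)).coeFn_toLp,
          (memLp_pairing hL h w v).coeFn_toLp, (memLp_pairing hL h w z).coeFn_toLp,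
          Lp.coeFn_add (memLp_pairing hL h w v).toLp (memLp_pairing hL h w z).toLp]
          with x h1 h2 h3 h4
        rw [h1, h4, Pi.add_apply, h2, h3, map_add, map_add, map_add]
      -- At `x`, the lifting of `f • v` differs from `ℓ(f)(x)` times the lifting of `v` by a vector
      -- of seminorm zero, and `ℓ(f) = f` almost everywhere.
      map_smul' := fun f v => by
        refine Lp.ext ?_
        filter_upwards [(memLp_pairing hL h w (f • v)).coeFn_toLp,
          (memLp_pairing hL h w v).coeFn_toLp, coeFn_mul f (memLp_pairing hL h w v).toLp,
          ℓ.limFun_ae_eq f] with x h1 h2 h3 h4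
        rw [h1, RingHom.id_apply, smul_eq_mul, h3, h2,
          FibreDual.apply_eq hL (w.1 x) (h.norm_lift_smul_sub hM f v x), map_smul, map_smul, h4,
          smul_eq_mul] }
  property := by
    obtain ⟨C, hC0, hC⟩ := w.2.2.exists_abs_le_mul hL w.2.1
    refine ⟨C, fun v => norm_le_of_ae (by positivity) ?_⟩
    filter_upwards [hC (lift v) ‖nM v‖ fun x => by
      rw [h.norm_lift_apply]
      exact (le_abs_self _).trans (ℓ.abs_limFun_le _ x),
      (memLp_pairing hL h w v).coeFn_toLp] with x h1 h2
    exact (congrArg abs h2).trans_le h1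

theorem coeFn_sectionFunctional (hM : IsNormedModule nM) {hL : IsBarNormedModule nL}
    (h : IsModuleLifting ℓ nM nL lift) (w : bddWeakSections ℓ hL) (v : M) :
    (sectionFunctional hM h w).1 v =ᵐ[μ] fun x => (w.1 x).1 (evalAt ℓ L x (lift v)) :=
  (memLp_pairing hL h w v).coeFn_toLp

/-- Equal functionals mean that `w - z` annihilates every lifted vector almost everywhere. The bound
`G = 0` in `abs_le_of_lift` extends this to all of `L`. One direction makes the map on classes well
defined, the other makes it injective. -/
theorem sectionFunctional_eq_iff (hM : IsNormedModule nM) {hL : IsBarNormedModule nL}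
    (h : IsModuleLifting ℓ nM nL lift) (w z : bddWeakSections ℓ hL) :
    sectionFunctional hM h w = sectionFunctional hM h z ↔
      LinftyWeak.mk w = LinftyWeak.mk z := by
  rw [LinftyWeak.mk_eq_mk]
  constructor
  · intro he u
    have key := h.abs_le_of_lift hL (w := (w - z).1) (G := 0) (fun v => by
      filter_upwards [coeFn_sectionFunctional hM h w v, coeFn_sectionFunctional hM h z v]
        with x h1 h2
      have h3 : ((w - z).1 x).1 (evalAt ℓ L x (lift v)) =
        (w.1 x).1 (evalAt ℓ L x (lift v)) - (z.1 x).1 (evalAt ℓ L x (lift v)) := rfl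
      rw [h3, ← h1, ← h2, he]
      simp) u
    filter_upwards [key] with x hx
    rw [Pi.zero_apply, zero_mul] at hx
    exact sub_eq_zero.1 (abs_nonpos_iff.1 hx)
  · intro he
    refine DualModule.ext_ae fun v => ?_
    filter_upwards [coeFn_sectionFunctional hM h w v, coeFn_sectionFunctional hM h z v,
      he (lift v)] with x h1 h2 h3
    rw [h1, h2]
    exact h3

/-- The map `[w] ↦ (v ↦ ⟨w, ℓ(v)⟩)` on equivalence classes of sections. -/
noncomputable def LinftyWeak.toDual (hM : IsNormedModule nM) {hL : IsBarNormedModule nL}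
    (h : IsModuleLifting ℓ nM nL lift) : LinftyWeak ℓ hL →ₗ[Lp ℝ ∞ μ] DualModule nM where
  toFun := Quotient.lift (sectionFunctional hM h) fun w z hwz =>
    (sectionFunctional_eq_iff hM h w z).2 (Quotient.sound hwz)
  map_add' := LinftyWeak.ind_mk fun w => LinftyWeak.ind_mk fun z => by
    change sectionFunctional hM h (w + z) = sectionFunctional hM h w + sectionFunctional hM h z
    refine DualModule.ext_ae fun v => ?_
    filter_upwards [coeFn_sectionFunctional hM h w v, coeFn_sectionFunctional hM h z v,
      coeFn_sectionFunctional hM h (w + z) v,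
      Lp.coeFn_add ((sectionFunctional hM h w).1 v) ((sectionFunctional hM h z).1 v)]
      with x h1 h2 h3 h4
    refine h3.trans (Eq.trans ?_ h4.symm)
    rw [Pi.add_apply, h1, h2]
    rfl
  map_smul' f := LinftyWeak.ind_mk fun w => by
    change sectionFunctional hM h (bddWeakSmul f w) = f • sectionFunctional hM h w
    refine DualModule.ext_ae fun v => ?_
    filter_upwards [coeFn_sectionFunctional hM h w v,
      coeFn_sectionFunctional hM h (bddWeakSmul f w) v,
      DualModule.coe_smul_apply f (sectionFunctional hM h w) v] with x h1 h2 h3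
    refine h2.trans (Eq.trans ?_ h3.symm)
    rw [h1]
    rfl

theorem LinftyWeak.toDual_mk (hM : IsNormedModule nM) {hL : IsBarNormedModule nL}
    (h : IsModuleLifting ℓ nM nL lift) (w : bddWeakSections ℓ hL) :
    LinftyWeak.toDual hM h (LinftyWeak.mk w) = sectionFunctional hM h w := rfl

theorem LinftyWeak.toDual_injective (hM : IsNormedModule nM) {hL : IsBarNormedModule nL}
    (h : IsModuleLifting ℓ nM nL lift) :
    Function.Injective (LinftyWeak.toDual (hL := hL) hM h) :=
  LinftyWeak.ind_mk fun w => LinftyWeak.ind_mk fun z =>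
    (sectionFunctional_eq_iff hM h w z).1

/-- For `‖v‖ ≤ 1` both `ℓ(v)` and `-ℓ(v)` are unit tests, which accounts for the absolute value and
gives `≤`. Conversely, `|T v| ≤ |T| |v|` bounds the couplings with lifted vectors, and this bound
passes to all test combinations. -/
theorem norm_sectionFunctional (hM : IsNormedModule nM) {hL : IsBarNormedModule nL}
    (h : IsModuleLifting ℓ nM nL lift) (w : bddWeakSections ℓ hL) :
    DualModule.norm (sectionFunctional hM h w) = LinftyWeak.norm (LinftyWeak.mk w) := by
  change _ = toLinfty (sectionNorm w.1) w.2.2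
  set T := sectionFunctional hM h w
  suffices hs : essSupSet {g | ∃ v, ‖nM v‖ ≤ 1 ∧ g =ᵐ[μ] fun x => ENNReal.ofReal |T.1 v x|} =
      sectionNorm w.1 by
    simp only [DualModule.norm, hs]
  apply le_antisymm
  · refine (isLUB_essSupSet {g | ∃ v, ‖nM v‖ ≤ 1 ∧
      g =ᵐ[μ] fun x => ENNReal.ofReal |T.1 v x|}).2 ?_
    rintro g ⟨v, hv, hg⟩
    have hu : IsUnitTest nL fun x => evalAt ℓ L x (lift v) := isUnitTest_evalAt hL fun x => by
      rw [h.norm_lift_apply]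
      exact (le_abs_self _).trans ((ℓ.abs_limFun_le _ x).trans hv)
    have hle : ∀ s, IsUnitTest nL s →
        ∀ᵐ x ∂μ, ENNReal.ofReal ((w.1 x).1 (s x)) ≤ sectionNorm w.1 x := fun s hs => by
      have hm : AEStronglyMeasurable (fun x => ENNReal.ofReal ((w.1 x).1 (s x))) μ :=
        (w.2.1.aemeasurable hs.1).ennreal_ofReal.aestronglyMeasurable
      have h1 : AEEqFun.mk _ hm ≤ sectionNorm w.1 :=
        (isLUB_essSupSet _).1 ⟨s, hs, AEEqFun.coeFn_mk _ hm⟩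
      filter_upwards [AEEqFun.coeFn_le.2 h1, AEEqFun.coeFn_mk _ hm] with x h2 h3
      exact h3 ▸ h2
    rw [← AEEqFun.coeFn_le]
    filter_upwards [hg, coeFn_sectionFunctional hM h w v, hle _ hu, hle _ (hu.neg hL)]
      with x h1 h2 h3 h4
    rw [h1, h2]
    rw [map_neg] at h4
    rcases abs_choice ((w.1 x).1 (evalAt ℓ L x (lift v))) with h5 | h5 <;> rw [h5]
    exacts [h3, h4]
  · refine (isLUB_essSupSet _).2 ?_
    rintro g ⟨s, hs, hg⟩
    have hb := IsTestCombination.abs_le hL (w := w.1) (G := DualModule.norm T)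
      (h.abs_le_of_lift hL fun v => by
        filter_upwards [DualModule.abs_apply_le hM T v, coeFn_sectionFunctional hM h w v,
          h.norm_lift_ae v] with x h1 h2 h3
        rw [← h2, h3]
        exact h1) hs.1
    rw [← AEEqFun.coeFn_le]
    filter_upwards [hg, hb, ofReal_toLinfty (essSupSet {g | ∃ v, ‖nM v‖ ≤ 1 ∧
      g =ᵐ[μ] fun x => ENNReal.ofReal |T.1 v x|}) _,
      coeFn_nonneg.2 (DualModule.norm_nonneg T)] with x h1 h2 h3 h4
    rw [h1, ← h3]
    exact ENNReal.ofReal_le_ofReal ((le_abs_self _).trans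
      (h2.trans (mul_le_of_le_one_right h4 (hs.2 x))))

/-! ### Sections representing a given functional -/

/-- A functional on `M` is represented, at each point, by a functional on the fibre. -/
theorem exists_fibre_functional (hM : IsNormedModule nM) (hL : IsBarNormedModule nL)
    (h : IsModuleLifting ℓ nM nL lift) (T : DualModule nM) (x : X) :
    ∃ φ : FibreDual ℓ nL x, (∀ v, φ.1 (evalAt ℓ L x (lift v)) = ℓ.limFun (T.1 v) x) ∧
      ∀ u : Fibre ℓ L x, |φ.1 u| ≤ ‖DualModule.norm T‖ * (nL u : X → ℝ) x := by
  set C := ‖DualModule.norm T‖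
  have hC : 0 ≤ C := norm_nonneg _
  let φ : M →ₗ[ℝ] ℝ :=
    { toFun := fun v => ℓ.limFun (T.1 v) x
      map_add' := fun v z => by rw [map_add, ℓ.limFun_add]
      map_smul' := fun c v => by
        rw [← algebraMap_smul (Lp ℝ ∞ μ) c v, map_smul, smul_eq_mul, ℓ.limFun_mul,
          Algebra.algebraMap_eq_smul_one, ℓ.limFun_smul, ℓ.limFun_one, mul_one]
        rfl }
  have hφ : ∀ v, |φ v| ≤ C * (nL (lift v) : X → ℝ) x := fun v => by
    rw [h.norm_lift_apply]
    have h1 : ∀ᵐ y ∂μ, (|T.1 v| : Lp ℝ ∞ μ) y ≤ (C • nM v : Lp ℝ ∞ μ) y := by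
      filter_upwards [DualModule.abs_apply_le hM T v, ae_abs_le_norm (DualModule.norm T),
        hM.coe_nonneg v, Lp.coeFn_abs (T.1 v), Lp.coeFn_smul C (nM v)] with y h1 h2 h3 h4 h5
      rw [h4, h5]
      exact h1.trans (mul_le_mul_of_nonneg_right ((le_abs_self _).trans h2) h3)
    have h2 := ℓ.limFun_le_of_ae h1 x
    rwa [ℓ.limFun_abs, ℓ.limFun_smul] at h2
  -- Domination by a multiple of the fibre seminorm makes `φ` descend to the image of `M` in the
  -- fibre and keeps the extension continuous. The constant `C` does not depend on `x`.
  obtain ⟨g, hg, hgN⟩ := exists_functional_comp_eq ((evalAt ℓ L x).comp lift) φ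
    (fun u => C * (nL u : X → ℝ) x)
    (fun c hc u => by
      change C * (nL (c • (u : L)) : X → ℝ) x = _
      rw [hL.norm_smul_real, abs_of_pos hc]; ring)
    (fun u z => by
      rw [← mul_add]
      exact mul_le_mul_of_nonneg_left (hL.add_le u z x) hC)
    (fun v => by
      refine (le_abs_self _).trans ((hφ v).trans_eq ?_)
      rw [LinearMap.comp_apply, norm_evalAt hL])
  have hb : ∀ u : Fibre ℓ L x, |g u| ≤ C * (nL u : X → ℝ) x := fun u => by
    refine abs_le'.2 ⟨hgN u, ?_⟩
    have h1 := hgN (-u)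
    rw [map_neg] at h1
    refine h1.trans_eq ?_
    change C * (nL (-(u : L)) : X → ℝ) x = _
    rw [hL.norm_neg]
  exact ⟨⟨g, C, hb⟩, hg, hb⟩

/-- The fibre functionals are chosen with no regard to measurability, but on lifted vectors they are
prescribed by `ℓ(T v)`. The common bound `‖|T|‖` then makes every coupling a limit of patched
functions of this kind. -/
theorem LinftyWeak.toDual_surjective (hM : IsNormedModule nM) {hL : IsBarNormedModule nL}
    (h : IsModuleLifting ℓ nM nL lift) :
    Function.Surjective (LinftyWeak.toDual (hL := hL) hM h) := by
  intro T
  choose w hw hb using exists_fibre_functional hM hL h T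
  have hmeas : WeaklyMeasurable (nL := nL) w := fun u => by
    choose idx v hidx hv using fun k : ℕ =>
      h.exists_approx hL u (Nat.one_div_pos_of_nat (α := ℝ) (n := k))
    have hF : ∀ k, NullMeasurable (fun x => ℓ.limFun (T.1 (v k (idx k x))) x) μ := fun k =>
      nullMeasurable_patch (hidx k) fun n => ℓ.nullMeasurable_limFun (T.1 (v k n))
    have hlim : ∀ x, Tendsto (fun k => ℓ.limFun (T.1 (v k (idx k x))) x) atTop
        (𝓝 ((w x).1 (evalAt ℓ L x u))) := fun x => by
      rw [tendsto_iff_norm_sub_tendsto_zero]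
      have h0 := (tendsto_one_div_add_atTop_nhds_zero_nat (𝕜 := ℝ)).const_mul
        ‖DualModule.norm T‖
      rw [mul_zero] at h0
      refine squeeze_zero (fun k => norm_nonneg _) (fun k => ?_) h0
      rw [← hw, ← map_sub, ← map_sub, Real.norm_eq_abs]
      refine (hb x _).trans (mul_le_mul_of_nonneg_left ?_ (norm_nonneg _))
      rw [norm_evalAt hL, hL.norm_sub_comm]
      exact hv k x
    have : NullMeasurable (fun x => (w x).1 (evalAt ℓ L x u)) μ :=
      measurable_of_tendsto_metrizable (α := NullMeasurableSpace X μ) hF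
        (tendsto_pi_nhds.2 hlim)
    exact this.aemeasurable
  have hbdd : EssBounded (nL := nL) w :=
    .of_le ‖DualModule.norm T‖ fun s hs => ae_of_all _ fun x =>
      (le_abs_self _).trans ((hb x (s x)).trans (mul_le_of_le_one_right (norm_nonneg _) (hs.2 x)))
  refine ⟨LinftyWeak.mk ⟨w, hmeas, hbdd⟩, DualModule.ext_ae fun v => ?_⟩
  rw [LinftyWeak.toDual_mk]
  filter_upwards [coeFn_sectionFunctional hM h ⟨w, hmeas, hbdd⟩ v, ℓ.limFun_ae_eq (T.1 v)]
    with x h1 h2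
  rw [h1, ← h2]
  exact hw x v

/-- The isomorphism between the space of sections and the dual module. -/
noncomputable def LinftyWeak.equivDual (hM : IsNormedModule nM) {hL : IsBarNormedModule nL}
    (h : IsModuleLifting ℓ nM nL lift) : LinftyWeak ℓ hL ≃ₗ[Lp ℝ ∞ μ] DualModule nM :=
  LinearEquiv.ofBijective (LinftyWeak.toDual hM h)
    ⟨LinftyWeak.toDual_injective hM h, LinftyWeak.toDual_surjective hM h⟩

theorem LinftyWeak.norm_equivDual (hM : IsNormedModule nM) {hL : IsBarNormedModule nL}
    (h : IsModuleLifting ℓ nM nL lift) :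
    ∀ q, DualModule.norm (LinftyWeak.equivDual (hL := hL) hM h q) = LinftyWeak.norm q :=
  LinftyWeak.ind_mk fun w => norm_sectionFunctional hM h w

end

section

/-! ### Modules of sections of a family of Banach spaces -/

section Sections

variable {X : Type*} [MeasurableSpace X] {μ : Measure X} {M : Type*} [AddCommGroup M] [Module ℝ M]
  {V : X → Type*} [∀ x, NormedAddCommGroup (V x)] [∀ x, NormedSpace ℝ (V x)]

noncomputable instance : Module (BddFun μ) (∀ x, V x) :=
  Subalgebra.moduleLeft (BddFun μ)

instance : IsScalarTower ℝ (BddFun μ) (∀ x, V x) :=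
  ⟨fun c f s => funext fun x => mul_smul c ((f : X → ℝ) x) (s x)⟩

/-- `s` is a uniform limit of sections of the form `x ↦ val x (v n)`, `x ∈ E n`, for countable
partitions `E` in `Σ̄` (recorded by an index function). -/
def IsPatchLimit (μ : Measure X) (val : ∀ x, M →ₗ[ℝ] V x) (s : ∀ x, V x) : Prop :=
  ∀ ε > 0, ∃ (idx : X → ℕ) (v : ℕ → M), NullMeasurable idx μ ∧
    ∀ x, ‖s x - val x (v (idx x))‖ ≤ ε

/-- Refining two partitions, or adding a discretized coefficient, naturally produces pairs as
indices. -/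
theorem IsPatchLimit.of_encodable {val : ∀ x, M →ₗ[ℝ] V x} {s : ∀ x, V x}
    (ι : Type) [Encodable ι] [MeasurableSpace ι] [DiscreteMeasurableSpace ι]
    (h : ∀ ε > 0, ∃ (idx : X → ι) (v : ι → M), NullMeasurable idx μ ∧
      ∀ x, ‖s x - val x (v (idx x))‖ ≤ ε) : IsPatchLimit μ val s := by
  intro ε hε
  obtain ⟨idx, v, hidx, hv⟩ := h ε hε
  -- The default `0` concerns numbers that encode nothing, which the index function never takes.
  refine ⟨fun x => Encodable.encode (idx x), fun n => ((Encodable.decode n).map v).getD 0,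
    (Measurable.of_discrete (f := Encodable.encode (α := ι))).comp_nullMeasurable hidx,
    fun x => ?_⟩
  simpa using hv x

theorem nullMeasurable_prodMk {β γ : Type*} [MeasurableSpace β] [MeasurableSpace γ] {f : X → β}
    {g : X → γ} (hf : NullMeasurable f μ) (hg : NullMeasurable g μ) :
    NullMeasurable (fun x => (f x, g x)) μ :=
  Measurable.prodMk (α := NullMeasurableSpace X μ) hf hg

theorem IsPatchLimit.of_approx {val : ∀ x, M →ₗ[ℝ] V x} {s : ∀ x, V x}
    (h : ∀ ε > 0, ∃ t, IsPatchLimit μ val t ∧ ∀ x, ‖s x - t x‖ ≤ ε) : IsPatchLimit μ val s := by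
  intro ε hε
  obtain ⟨t, ht, hst⟩ := h (ε / 2) (half_pos hε)
  obtain ⟨idx, v, hidx, hv⟩ := ht (ε / 2) (half_pos hε)
  refine ⟨idx, v, hidx, fun x => ?_⟩
  have := norm_sub_le_norm_sub_add_norm_sub (s x) (t x) (val x (v (idx x)))
  linarith [hst x, hv x]

theorem IsPatchLimit.add {val : ∀ x, M →ₗ[ℝ] V x} {s t : ∀ x, V x} (hs : IsPatchLimit μ val s)
    (ht : IsPatchLimit μ val t) : IsPatchLimit μ val (s + t) := by
  refine .of_encodable (ℕ × ℕ) fun ε hε => ?_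
  obtain ⟨i, v, hi, hv⟩ := hs (ε / 2) (half_pos hε)
  obtain ⟨j, z, hj, hz⟩ := ht (ε / 2) (half_pos hε)
  refine ⟨fun x => (i x, j x), fun p => v p.1 + z p.2, nullMeasurable_prodMk hi hj, fun x => ?_⟩
  have h1 : (s + t) x - val x (v (i x) + z (j x)) =
      (s x - val x (v (i x))) + (t x - val x (z (j x))) := by
    rw [map_add, Pi.add_apply]; abel
  rw [h1]
  linarith [norm_add_le (s x - val x (v (i x))) (t x - val x (z (j x))), hv x, hz x]

/-- On a piece only real multiples of elements of `M` are available, so `f` is rounded down to a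
multiple of `η` and the integer `⌊f / η⌋` joins the index. The bound on `s` controls the rounding
error. -/
theorem IsPatchLimit.smul {val : ∀ x, M →ₗ[ℝ] V x} {s : ∀ x, V x} (hs : IsPatchLimit μ val s)
    {B : ℝ} (hB : ∀ x, ‖s x‖ ≤ B) (f : BddFun μ) : IsPatchLimit μ val (f • s) := by
  obtain ⟨D, hD⟩ := f.2.2
  refine .of_encodable (ℤ × ℕ) fun ε hε => ?_
  -- The error is at most `|D| η` from approximating `s` plus `(|B| + 1) η` from rounding `f`; `η ≤
  -- 1` ensures that the approximating vectors have norm at most `|B| + 1`.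
  set K := |D| + |B| + 1
  have hK : 0 < K := by positivity
  obtain ⟨η, hη0, hη1, hη⟩ : ∃ η : ℝ, 0 < η ∧ η ≤ 1 ∧ K * η ≤ ε :=
    ⟨min 1 (ε / K), lt_min one_pos (div_pos hε hK), min_le_left _ _,
      (mul_le_mul_of_nonneg_left (min_le_right _ _) hK.le).trans_eq (mul_div_cancel₀ ε hK.ne')⟩
  obtain ⟨i, v, hi, hv⟩ := hs η hη0
  have hfl : NullMeasurable (fun x => ⌊(f : X → ℝ) x / η⌋) μ :=
    Int.measurable_floor.comp_nullMeasurable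
      ((measurable_id.div_const η).comp_nullMeasurable f.2.1)
  refine ⟨fun x => (⌊(f : X → ℝ) x / η⌋, i x), fun p => ((p.1 : ℝ) * η) • v p.2,
    nullMeasurable_prodMk hfl hi, fun x => ?_⟩
  set a := (f : X → ℝ) x
  set q := (⌊a / η⌋ : ℝ) * η
  set z := val x (v (i x))
  have hq : |a - q| ≤ η := by
    have h1 := Int.floor_le (a / η)
    have h2 := (Int.lt_floor_add_one (a / η)).le
    rw [le_div_iff₀ hη0] at h1
    rw [div_le_iff₀ hη0, add_mul, one_mul] at h2
    rw [abs_le]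
    constructor <;> linarith
  have hz : ‖z‖ ≤ |B| + 1 := by
    have h1 := norm_le_insert (s x) z
    linarith [hv x, hB x, le_abs_self B]
  have h1 : (f • s) x - val x (q • v (i x)) = a • (s x - z) + (a - q) • z := by
    rw [map_smul, smul_sub, sub_smul]
    change a • s x - q • z = _
    abel
  calc ‖(f • s) x - val x (q • v (i x))‖ ≤ ‖a • (s x - z)‖ + ‖(a - q) • z‖ := by
        rw [h1]; exact norm_add_le _ _
    _ ≤ |D| * η + η * (|B| + 1) := by
        rw [norm_smul, norm_smul]
        exact add_le_add
          (mul_le_mul ((hD x).trans (le_abs_self D)) (hv x) (norm_nonneg _) (abs_nonneg _))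
          (mul_le_mul hq hz (norm_nonneg _) hη0.le)
    _ = K * η := by ring
    _ ≤ ε := hη

/-- The module of bounded sections that are uniform limits of patched sections. -/
def patchSections (μ : Measure X) (val : ∀ x, M →ₗ[ℝ] V x) : Submodule (BddFun μ) (∀ x, V x) where
  carrier := {s | IsPatchLimit μ val s ∧ ∃ C, ∀ x, ‖s x‖ ≤ C}
  add_mem' := by
    rintro s t ⟨hs, C, hC⟩ ⟨ht, D, hD⟩
    exact ⟨hs.add ht, C + D, fun x => 
      (norm_add_le (s x) (t x)).trans (add_le_add (hC x) (hD x))⟩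
  zero_mem' := ⟨fun ε hε => ⟨fun _ => 0, fun _ => 0, measurable_const.nullMeasurable,
    fun x => by simp [hε.le]⟩, 0, fun x => by simp⟩
  smul_mem' := by
    rintro f s ⟨hs, C, hC⟩
    obtain ⟨D, hD⟩ := f.2.2
    refine ⟨hs.smul hC f, D * C, fun x => ?_⟩
    change ‖(f : X → ℝ) x • s x‖ ≤ D * C
    rw [norm_smul]
    exact mul_le_mul (hD x) (hC x) (norm_nonneg _) ((abs_nonneg _).trans (hD x))

variable {val : ∀ x, M →ₗ[ℝ] V x}

noncomputable instance : AddCommGroup (patchSections μ val) := Submodule.addCommGroup _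

noncomputable instance : Module (BddFun μ) (patchSections μ val) := Submodule.module _

noncomputable instance : SMul (BddFun μ) (patchSections μ val) := Module.toDistribMulAction.toSMul

noncomputable instance : Module ℝ (patchSections μ val) := Submodule.module' _

instance : IsScalarTower ℝ (BddFun μ) (patchSections μ val) :=
  ⟨fun c f s => Subtype.ext (smul_assoc c f s.1)⟩

theorem IsPatchLimit.nullMeasurable_norm (hval : ∀ v, NullMeasurable (fun x => ‖val x v‖) μ)
    {s : ∀ x, V x} (hs : IsPatchLimit μ val s) : NullMeasurable (fun x => ‖s x‖) μ := by
  choose idx v hidx hv using fun k : ℕ => hs _ (Nat.one_div_pos_of_nat (α := ℝ) (n := k))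
  have hlim : ∀ x : X, Tendsto (fun k => val x (v k (idx k x))) atTop (𝓝 (s x)) := fun x => by
    rw [tendsto_iff_norm_sub_tendsto_zero]
    refine squeeze_zero (fun k => norm_nonneg _) (fun k => ?_)
      (tendsto_one_div_add_atTop_nhds_zero_nat (𝕜 := ℝ))
    rw [norm_sub_rev]
    exact hv k x
  exact measurable_of_tendsto_metrizable (α := NullMeasurableSpace X μ)
    (f := fun k (x : X) => ‖val x (v k (idx k x))‖)
    (fun k => nullMeasurable_patch (hidx k) fun n => hval (v k n))
    (tendsto_pi_nhds.2 fun x : X => (hlim x).norm)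

/-- The pointwise norm of a section. -/
noncomputable def patchNorm (hval : ∀ v, NullMeasurable (fun x => ‖val x v‖) μ)
    (s : patchSections μ val) : BddFun μ :=
  ⟨fun x => ‖s.1 x‖, s.2.1.nullMeasurable_norm hval, s.2.2.imp fun _ hC x => by
    rw [abs_norm]; exact hC x⟩

theorem patchNorm_apply (hval : ∀ v, NullMeasurable (fun x => ‖val x v‖) μ)
    (s : patchSections μ val) (x : X) : (patchNorm hval s : X → ℝ) x = ‖s.1 x‖ := rfl

/-- At a fixed accuracy each `s n` has its own partition. The number of the piece `E n` together
with the index for `s n` describes a countable partition that serves the glued section. -/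
theorem exists_patch_glue {E : ℕ → Set X} (hE : ∀ n, NullMeasurableSet (E n) μ)
    (hd : Pairwise (Function.onFun Disjoint E)) (hu : ⋃ n, E n = univ)
    (s : ℕ → patchSections μ val) {C : ℝ} (hC : ∀ n, ∀ x ∈ E n, ‖(s n).1 x‖ ≤ C) :
    ∃ t : patchSections μ val, ∀ n, barInd μ (E n) (hE n) • t = barInd μ (E n) (hE n) • s n := by
  obtain ⟨k, hk⟩ := exists_index hd hu
  have hmem : ∀ x, x ∈ E (k x) := fun x => by rw [← hk]; rfl
  refine ⟨⟨fun x => (s (k x)).1 x, .of_encodable (ℕ × ℕ) fun ε hε => ?_, C, fun x =>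
    hC _ x (hmem x)⟩, fun n => Subtype.ext (funext fun x => ?_)⟩
  · choose idx v hidx hv using fun n => (s n).2.1 ε hε
    exact ⟨fun x => (k x, idx (k x) x), fun p => v p.1 p.2,
      nullMeasurable_prodMk (nullMeasurable_index hE hk)
        (nullMeasurable_patch (nullMeasurable_index hE hk) hidx),
      fun x => hv (k x) x⟩
  · change (E n).indicator (fun _ => (1 : ℝ)) x • (s (k x)).1 x =
      (E n).indicator (fun _ => (1 : ℝ)) x • (s n).1 x
    by_cases hx : x ∈ E n
    · have : k x = n := by rw [← hk] at hx; exact hx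
      rw [this]
    · simp [hx]

theorem exists_patch_limit [∀ x, CompleteSpace (V x)] (s : ℕ → patchSections μ val)
    (hs : ∀ ε > 0, ∃ N, ∀ m ≥ N, ∀ n ≥ N, ∀ x, ‖(s m).1 x - (s n).1 x‖ ≤ ε) :
    ∃ t : patchSections μ val, ∀ ε > 0, ∃ N, ∀ n ≥ N, ∀ x, ‖(s n).1 x - t.1 x‖ ≤ ε := by
  have hcau : ∀ x, CauchySeq fun n => (s n).1 x := fun x => by
    rw [Metric.cauchySeq_iff]
    intro ε hε
    obtain ⟨N, hN⟩ := hs (ε / 2) (half_pos hε)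
    refine ⟨N, fun m hm n hn => ?_⟩
    rw [dist_eq_norm]
    exact (hN m hm n hn x).trans_lt (half_lt_self hε)
  choose t ht using fun x => cauchySeq_tendsto_of_complete (hcau x)
  have hlim : ∀ ε > 0, ∃ N, ∀ n ≥ N, ∀ x, ‖(s n).1 x - t x‖ ≤ ε := fun ε hε => by
    obtain ⟨N, hN⟩ := hs ε hε
    refine ⟨N, fun n hn x => le_of_tendsto ((ht x).const_sub ((s n).1 x)).norm ?_⟩
    filter_upwards [eventually_ge_atTop N] with m hm using hN n hn m hm x
  refine ⟨⟨t, .of_approx fun ε hε => ?_, ?_⟩, hlim⟩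
  · obtain ⟨N, hN⟩ := hlim ε hε
    exact ⟨(s N).1, (s N).2.1, fun x => by rw [norm_sub_rev]; exact hN N le_rfl x⟩
  · obtain ⟨N, hN⟩ := hlim 1 one_pos
    obtain ⟨C, hC⟩ := (s N).2.2
    refine ⟨C + 1, fun x => (norm_le_insert ((s N).1 x) (t x)).trans ?_⟩
    exact add_le_add (hC x) (hN N le_rfl x)

theorem isBarNormedModule_patchNorm [∀ x, CompleteSpace (V x)]
    (hval : ∀ v, NullMeasurable (fun x => ‖val x v‖) μ) :
    IsBarNormedModule (patchNorm hval) where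
  nonneg s x := norm_nonneg _
  eq_zero_iff s := by
    constructor
    · intro h
      refine Subtype.ext (funext fun x => norm_eq_zero.1 ?_)
      rw [← patchNorm_apply hval, h]; rfl
    · rintro rfl
      exact Subtype.ext (funext fun x => norm_zero)
  add_le s t x := norm_add_le _ _
  smul f s x := norm_smul ((f : X → ℝ) x) (s.1 x)
  glue E hE hd hu s := fun ⟨_, hC⟩ => exists_patch_glue hE hd hu s hC
  complete s hs := exists_patch_limit s hs

end Sections

/-! ### Existence of liftings of modules -/

section Existence

variable {X : Type*} [MeasurableSpace X] {μ : Measure X} (ℓ : Lifting μ)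
  {M : Type*} [AddCommGroup M] [Module (Lp ℝ ∞ μ) M]
  [Module ℝ M] [IsScalarTower ℝ (Lp ℝ ∞ μ) M] {nM : M → Lp ℝ ∞ μ} (hM : IsNormedModule nM)

/-- The module `M` with the seminorm `v ↦ ℓ(|v|)(x)`. -/
def PointedModule (_ : Lifting μ) (_ : IsNormedModule nM) (_ : X) : Type _ := M

namespace PointedModule

variable (x : X)

instance : AddCommGroup (PointedModule ℓ hM x) := inferInstanceAs (AddCommGroup M)

noncomputable instance : Module ℝ (PointedModule ℓ hM x) := inferInstanceAs (Module ℝ M)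

noncomputable instance : Norm (PointedModule ℓ hM x) := ⟨fun v => ℓ.limFun (nM v) x⟩

omit [Module ℝ M] [IsScalarTower ℝ (Lp ℝ ∞ μ) M] in
theorem norm_def (v : PointedModule ℓ hM x) : ‖v‖ = ℓ.limFun (nM v) x := rfl

theorem core : SeminormedSpace.Core ℝ (PointedModule ℓ hM x) where
  norm_nonneg v := ℓ.limFun_nonneg (hM.nonneg v) x
  norm_smul c v := by
    have h : (c • v : M) = algebraMap ℝ (Lp ℝ ∞ μ) c • (show M from v) :=
      (algebraMap_smul _ c (show M from v)).symm
    have h2 : nM (c • v : M) = |algebraMap ℝ (Lp ℝ ∞ μ) c| * nM v := by rw [h, hM.smul]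
    change ℓ.limFun (nM (c • v : M)) x = |c| * ℓ.limFun (nM v) x
    rw [h2, ℓ.limFun_mul, ℓ.limFun_abs, Algebra.algebraMap_eq_smul_one, ℓ.limFun_smul,
      ℓ.limFun_one, mul_one]
  norm_triangle v w := by
    rw [norm_def, norm_def, norm_def, ← ℓ.limFun_add]
    exact ℓ.limFun_mono (hM.add_le v w) x

noncomputable instance : SeminormedAddCommGroup (PointedModule ℓ hM x) :=
  .ofCore (core ℓ hM x)

noncomputable instance : NormedSpace ℝ (PointedModule ℓ hM x) where
  norm_smul_le c v := ((core ℓ hM x).norm_smul c v).le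

/-- The class of `v` in the completion of `M` for the seminorm at `x`. -/
noncomputable def toCompletion : M →ₗ[ℝ] UniformSpace.Completion (PointedModule ℓ hM x) :=
  (UniformSpace.Completion.toComplₗᵢ (𝕜 := ℝ) (E := PointedModule ℓ hM x)).toLinearMap

theorem norm_toCompletion (v : M) : ‖toCompletion ℓ hM x v‖ = ℓ.limFun (nM v) x :=
  UniformSpace.Completion.norm_coe (E := PointedModule ℓ hM x) v

theorem nullMeasurable_norm (v : M) :
    NullMeasurable (fun x => ‖toCompletion ℓ hM x v‖) μ := by
  simp only [norm_toCompletion]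
  exact ℓ.nullMeasurable_limFun _

end PointedModule

/-- The lifting of a normed module, realized by sections of the bundle of completions. -/
noncomputable abbrev LiftedModule := patchSections μ (PointedModule.toCompletion ℓ hM)

/-- The lifting map of `LiftedModule`. -/
noncomputable def LiftedModule.lift : M →ₗ[ℝ] LiftedModule ℓ hM where
  toFun v := ⟨fun x => PointedModule.toCompletion ℓ hM x v,
    fun ε hε => ⟨fun _ => 0, fun _ => v, measurable_const.nullMeasurable, fun x => by
      simp [hε.le]⟩,
    ‖nM v‖, fun x => by
      rw [PointedModule.norm_toCompletion]
      exact (le_abs_self _).trans (ℓ.abs_limFun_le _ x)⟩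
  map_add' v w := Subtype.ext (funext fun x => map_add _ v w)
  map_smul' c v := Subtype.ext (funext fun x => map_smul _ c v)

theorem LiftedModule.isModuleLifting :
    IsModuleLifting ℓ nM (patchNorm (PointedModule.nullMeasurable_norm ℓ hM))
      (LiftedModule.lift ℓ hM) where
  norm_lift v := Subtype.ext (funext fun x => PointedModule.norm_toCompletion ℓ hM x v)
  generates u ε hε := by
    obtain ⟨idx, v, hidx, hv⟩ := u.2.1 ε hε
    obtain ⟨C, hC⟩ := u.2.2
    have hE : ∀ n, NullMeasurableSet (idx ⁻¹' {n}) μ := fun n => hidx (measurableSet_singleton n)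
    have hd : Pairwise (Function.onFun Disjoint fun n => idx ⁻¹' {n}) := fun m n hmn =>
      disjoint_left.2 fun x hm hn => hmn (hm.symm.trans hn)
    have hu : ⋃ n, idx ⁻¹' {n} = univ := by ext; simp
    -- Glueing needs a uniform bound. On its own piece each lifted vector is within `ε` of the
    -- bounded section `u`.
    have hb : ∀ n, ∀ x ∈ idx ⁻¹' {n}, ‖(LiftedModule.lift ℓ hM (v n)).1 x‖ ≤ C + ε := by
      rintro _ x rfl
      exact (norm_le_insert (u.1 x) _).trans (add_le_add (hC x) (hv x))
    obtain ⟨g, hg⟩ := exists_patch_glue hE hd hu (fun n => LiftedModule.lift ℓ hM (v n)) hb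
    refine ⟨g, ⟨_, hE, _, hd, hu, fun n => ⟨v n, rfl⟩, ⟨C + ε, hb⟩, hg⟩, fun x => ?_⟩
    have h1 : g.1 x = PointedModule.toCompletion ℓ hM x (v (idx x)) := by
      have h2 : (idx ⁻¹' {idx x}).indicator (fun _ => (1 : ℝ)) x • g.1 x =
          (idx ⁻¹' {idx x}).indicator (fun _ => (1 : ℝ)) x •
            PointedModule.toCompletion ℓ hM x (v (idx x)) :=
        congrFun (congrArg Subtype.val (hg (idx x))) x
      simpa using h2
    change ‖u.1 x - g.1 x‖ ≤ ε
    rw [h1]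
    exact hv x

end Existence

end

end LinftyModule

/-! ### The representation theorem. -/

theorem mainTheorem4 {X : Type u} [MeasurableSpace X] (μ : Measure X) [SigmaFinite μ]
    (ℓ : Lifting μ)
    {M : Type v} [AddCommGroup M] [Module (Lp ℝ ∞ μ) M]
    [Module ℝ M] [IsScalarTower ℝ (Lp ℝ ∞ μ) M]
    (nM : M → Lp ℝ ∞ μ) (hM : IsNormedModule nM) :
    -- the lifting of `M` exists
    (∃ (L : Type (max u v)) (_ : AddCommGroup L) (_ : Module (BddFun μ) L)
      (_ : Module ℝ L) (_ : IsScalarTower ℝ (BddFun μ) L)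
      (nL : L → BddFun μ) (lift : M →ₗ[ℝ] L),
      IsBarNormedModule nL ∧ IsModuleLifting ℓ nM nL lift) ∧
    -- the description of the dual, for any realization `(L, lift)` of the lifting
    ∀ (L : Type w) [AddCommGroup L] [Module (BddFun μ) L]
      [Module ℝ L] [IsScalarTower ℝ (BddFun μ) L]
      (nL : L → BddFun μ) (hL : IsBarNormedModule nL) (lift : M →ₗ[ℝ] L),
      IsModuleLifting ℓ nM nL lift →
        IsNormedModule (LinftyWeak.norm (ℓ := ℓ) (hL := hL)) ∧
        ∃ I : LinftyWeak ℓ hL ≃ₗ[Lp ℝ ∞ μ] DualModule nM,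
          (∀ (ω : bddWeakSections ℓ hL) (v : M),
            ((I (LinftyWeak.mk ω)).1 v : X → ℝ) =ᵐ[μ]
              fun x => (ω.1 x).1 (valueAt ℓ (lift v) x)) ∧
          ∀ q : LinftyWeak ℓ hL, DualModule.norm (I q) = LinftyWeak.norm q := by
  refine ⟨⟨LiftedModule ℓ hM, inferInstance, inferInstance, inferInstance, inferInstance, _, _,
    isBarNormedModule_patchNorm _, LiftedModule.isModuleLifting ℓ hM⟩, ?_⟩
  intro L _ _ _ _ nL hL lift h
  -- Glueing and completeness of the space of sections come from the dual module, through the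
  -- isometric isomorphism.
  exact ⟨(DualModule.isNormedModule hM).of_equiv _ (LinftyWeak.norm_equivDual hM h),
    LinftyWeak.equivDual hM h, coeFn_sectionFunctional hM h, LinftyWeak.norm_equivDual hM h⟩
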